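/- Let $G$ be a negative definite plumbing graph that is a tree with finite vertex set $\mathcal J$, all genus decorations zero and integer Euler decorations $(e_j)_{j\in\mathcal J}$ (so the associated plumbed $3$-manifold is a rational homology sphere). Let $L=\bigoplus_{j\in\mathcal J}\mathbb Z E_j$ carry the intersection form $(E_j,E_j)=e_j$, and for $i\neq j$, $(E_i,E_j)=1$ if $i,j$ are adjacent and $0$ otherwise; it is negative definite. Let $L'=\{l'\in L\otimes\mathbb Q:(l',L)\subseteq\mathbb Z\}$ and let $\mathrm{Char}=\{k\in L':(k,x)+(x,x)\in 2\mathbb Z\ \text{for all }x\in L\}$ be the set of characteristic elements. For $k\in \mathrm{Char}$ put $\chi_k(l)=-(l,l+k)/2$ ($l\in L$), and let $k_{can}\in \mathrm{Char}$ be given by $(k_{can},E_j)=-(E_j,E_j)-2$ for all $j$. A negative definite connected graph is rational if $\chi_{k_{can}}(l)>0$ for every $l\in L$ with $l>0$ (i.e. $l\ne0$ has non-negative coefficients). The graph $G$ has $\nu$ bad vertices if there is a set of $\nu$ vertices such that replacing their decorations $e_j$ by some integers $e'_j\le e_j$ (and keeping all the others) gives a rational graph. For $k\in\mathrm{Char}$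 the lattice cohomology $\mathbb H^*(G,k)$ is defined as follows. Fix a total order on $\mathcal J$. For $l\in L$ and $I\subseteq\mathcal J$ with $|I|=q$ let $(l,I)$ be the $q$-cube in $L\otimes\mathbb R$ with vertices $l+\sum_{j\in I'}E_j$, $I'\subseteq I$, oriented by the order of $I$; its weight $w(l,I)$ is the maximum of $\chi_k$ over its vertices. Let $\mathcal C_q$ be the free $\mathbb Z$-module on the oriented $q$-cubes, with the cubical boundary $\partial$, let $\mathcal T^+_0=\mathbb Z[U,U^{-1}]/U\cdot\mathbb Z[U]$ and $\mathcal F^q=\mathrm{Hom}_{\mathbb Z}(\mathcal C_q,\mathcal T_0^+)$, and define $\delta_w:\mathcal F^q\to\mathcal F^{q+1}$ by $(\delta_w\phi)(\square)=\sum_m\varepsilon_m\,U^{w(\square)-w(\square_m)}\phi(\square_m)$, where $\partial\square=\sum_m\varepsilon_m\square_m$. Then $\mathbb H^q(G,k)$ is the $q$-th cohomology of the complex of $\mathbb Z[U]$-modules $(\mathcal F^*,\delta_w)$. Fix $\nu\ge 1$. If $G$ has $\nu$ bad vertices, then $\mathbb H^q(G,k)=0$ for every $q\ge\nu$ and every $k\in\mathrm{Char}$.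 -/

import Mathlib

/-! ### Lattice cohomology of a weighted free `ℤ`-module `ℤ^V` with fixed ordered basis -/

/-- The `ℤ[U]`-module `𝒯₀⁺ = ℤ[U, U⁻¹] / U · ℤ[U]`; here `U` is the variable `X` of `ℤ[X]`, which acts
on Laurent polynomials as multiplication by `T`. -/
abbrev TPlus : Type :=
  LaurentPolynomial ℤ ⧸
    (Submodule.span (Polynomial ℤ) {(LaurentPolynomial.T 1 : LaurentPolynomial ℤ)})

/-- The `q`-dimensional cube `(l, I)`, `l ∈ ℤ^V`, `I ⊆ V`, `|I| = q`, of the cubical decomposition of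
`ℝ^V`: its vertices are the points `l + ∑_{j ∈ I'} E_j` for `I' ⊆ I`.  It is oriented by the order of
the basis elements in the directions `I`. -/
@[ext] structure LatticeCube (V : Type*) (q : ℕ) where
  corner : V → ℤ
  dirs : Finset V
  card_dirs : dirs.card = q

namespace LatticeCube

variable {V : Type*} [LinearOrder V] {q : ℕ}

/-- The codimension one faces of a cube are indexed by a direction `j` of the cube and a choice between
the upper face (`true`, through `l + E_j`) and the lower face (`false`, through `l`). -/
abbrev FaceIndex (c : LatticeCube V q) : Type _ := {j : V // j ∈ c.dirs} × Bool

/-- The face of the cube `(l, I)` with index `(j, b)`: it is `(l + E_j, I \ {j})` if `b` is `true` and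
`(l, I \ {j})` if `b` is `false`. -/
def face (c : LatticeCube V (q + 1)) (f : c.FaceIndex) : LatticeCube V q where
  corner := c.corner + if f.2 then Pi.single f.1.1 1 else 0
  dirs := c.dirs.erase f.1.1
  card_dirs := by rw [Finset.card_erase_of_mem f.1.2, c.card_dirs]; rfl

/-- The sign of a face in the oriented boundary: with `I = {j₁ < ⋯ < j_q}` it is `(-1)^(m-1)` for the
upper face and `-(-1)^(m-1)` for the lower face in the direction `j_m`. -/
def faceSign (c : LatticeCube V (q + 1)) (f : c.FaceIndex) : ℤ :=
  (-1) ^ (c.dirs.filter (· < f.1.1)).card * if f.2 then 1 else -1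

/-- The weight of a cube: the maximum of the weights of its vertices. -/
def weight (w : (V → ℤ) → ℤ) (c : LatticeCube V q) : ℤ :=
  c.dirs.powerset.sup' ⟨∅, Finset.empty_mem_powerset _⟩
    fun I' => w (c.corner + ∑ j ∈ I', Pi.single j 1)

/-- The weight of a face is at most the weight of the cube. -/
theorem weight_face_le (w : (V → ℤ) → ℤ) (c : LatticeCube V (q + 1)) (f : c.FaceIndex) :
    (c.face f).weight w ≤ c.weight w := by
  obtain ⟨⟨j, hj⟩, b⟩ := f
  refine Finset.sup'_le _ _ fun I' hI' => ?_
  rw [Finset.mem_powerset] at hI'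
  have hI : I' ⊆ c.dirs.erase j := hI'
  have hjI : j ∉ I' := fun h => by simpa using hI h
  cases b with
  | false =>
    have h : I' ∈ c.dirs.powerset :=
      Finset.mem_powerset.2 (hI.trans (Finset.erase_subset _ _))
    have := Finset.le_sup' (fun I' => w (c.corner + ∑ j ∈ I', Pi.single j 1)) h
    simpa [face, weight] using this
  | true =>
    have h : insert j I' ∈ c.dirs.powerset :=
      Finset.mem_powerset.2
        (Finset.insert_subset hj (hI.trans (Finset.erase_subset _ _)))
    have := Finset.le_sup' (fun I' => w (c.corner + ∑ j ∈ I', Pi.single j 1)) h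
    simpa [face, weight, Finset.sum_insert hjI, add_assoc] using this

end LatticeCube

/-- The free `ℤ`-module `𝒞_q` on the oriented `q`-cubes. -/
abbrev LatticeChain (V : Type*) (q : ℕ) : Type _ := LatticeCube V q →₀ ℤ

/-- The `ℤ[U]`-module `ℱ^q = Hom_ℤ(𝒞_q, 𝒯₀⁺)`. -/
abbrev LatticeCochain (V : Type*) (q : ℕ) : Type _ := LatticeChain V q →ₗ[ℤ] TPlus

section Cohomology

variable {V : Type*} [LinearOrder V]

/-- The coboundary
`(δ_w φ)(□) = ∑_k ε_k U^(w(□) - w(□_k)) φ(□_k)`, where `∂□ = ∑_k ε_k □_k`. -/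
noncomputable def latticeCoboundary (w : (V → ℤ) → ℤ) (q : ℕ) :
    LatticeCochain V q →ₗ[Polynomial ℤ] LatticeCochain V (q + 1) where
  toFun φ := Finsupp.linearCombination ℤ fun c : LatticeCube V (q + 1) =>
    ∑ f : c.FaceIndex, c.faceSign f •
      (Polynomial.X : Polynomial ℤ) ^ (c.weight w - (c.face f).weight w).toNat •
        φ (Finsupp.single (c.face f) 1)
  map_add' φ ψ := by
    ext c
    simp [Finset.sum_add_distrib]
  map_smul' p φ := by
    ext c
    simp only [LinearMap.coe_comp, Function.comp_apply, Finsupp.lsingle_apply,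
      Finsupp.linearCombination_single, one_smul, LinearMap.smul_apply, RingHom.id_apply,
      Finset.smul_sum]
    refine Finset.sum_congr rfl fun f _ => ?_
    rw [smul_comm p, smul_comm p]

theorem latticeCoboundary_single (w : (V → ℤ) → ℤ) (q : ℕ) (φ : LatticeCochain V q)
    (c : LatticeCube V (q + 1)) :
    latticeCoboundary w q φ (Finsupp.single c 1) =
      ∑ f : c.FaceIndex, c.faceSign f •
        (Polynomial.X : Polynomial ℤ) ^ (c.weight w - (c.face f).weight w).toNat •
          φ (Finsupp.single (c.face f) 1) := by
  simp [latticeCoboundary]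

/-- The coboundaries of degree `q`: the image of `δ_w` in `ℱ^q` (zero for `q = 0`). -/
noncomputable def latticeCoboundaries (w : (V → ℤ) → ℤ) :
    (q : ℕ) → Submodule (Polynomial ℤ) (LatticeCochain V q)
  | 0 => ⊥
  | q + 1 => LinearMap.range (latticeCoboundary w q)

/-- The lattice cohomology `ℍ^q(ℝ^V, w)`, a `ℤ[U]`-module: cocycles modulo coboundaries. -/
abbrev LatticeCohomology (w : (V → ℤ) → ℤ) (q : ℕ) : Type _ :=
  LinearMap.ker (latticeCoboundary w q) ⧸
    (latticeCoboundaries w q).submoduleOf (LinearMap.ker (latticeCoboundary w q))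

theorem faceSign_swap {q : ℕ} (c : LatticeCube V (q + 1 + 1)) {i j : V} (hi : i ∈ c.dirs)
    (hj : j ∈ c.dirs) (hij : i < j) (a b : Bool) (hi' : i ∈ (c.face (⟨j, hj⟩, b)).dirs)
    (hj' : j ∈ (c.face (⟨i, hi⟩, a)).dirs) :
    c.faceSign (⟨i, hi⟩, a) * (c.face (⟨i, hi⟩, a)).faceSign (⟨j, hj'⟩, b) =
      -(c.faceSign (⟨j, hj⟩, b) * (c.face (⟨j, hj⟩, b)).faceSign (⟨i, hi'⟩, a)) := by
  simp only [LatticeCube.faceSign, LatticeCube.face]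
  have h1 : (c.dirs.filter (· < j)).card = ((c.dirs.erase i).filter (· < j)).card + 1 := by
    rw [Finset.filter_erase, Finset.card_erase_add_one]
    simp [hi, hij]
  have h2 : (c.dirs.erase j).filter (· < i) = c.dirs.filter (· < i) := by
    rw [Finset.filter_erase, Finset.erase_eq_of_notMem]
    simp [hij.le]
  rw [h1, h2, pow_succ]
  ring

/-- `δ_w ∘ δ_w = 0`. -/
theorem latticeCoboundary_comp (w : (V → ℤ) → ℤ) (q : ℕ) (φ : LatticeCochain V q) :
    latticeCoboundary w (q + 1) (latticeCoboundary w q φ) = 0 := by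
  ext c
  simp only [LinearMap.coe_comp, Function.comp_apply, Finsupp.lsingle_apply,
    latticeCoboundary_single, LinearMap.zero_apply, Finset.smul_sum]
  rw [Finset.sum_sigma']
  refine Finset.sum_involution
    (fun x _ => ⟨(⟨x.2.1.1, Finset.mem_of_mem_erase x.2.1.2⟩, x.2.2),
      (⟨x.1.1.1, Finset.mem_erase.2
        ⟨(Finset.ne_of_mem_erase x.2.1.2).symm, x.1.1.2⟩⟩, x.1.2)⟩) ?_ ?_ ?_ ?_
  · rintro ⟨⟨⟨j, hj⟩, b⟩, ⟨⟨i, hi'⟩, a⟩⟩ -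
    have hij : i ≠ j := Finset.ne_of_mem_erase hi'
    have hi : i ∈ c.dirs := Finset.mem_of_mem_erase hi'
    have hj' : j ∈ (c.face (⟨i, hi⟩, a)).dirs := Finset.mem_erase.2 ⟨hij.symm, hj⟩
    have hface : (c.face (⟨i, hi⟩, a)).face (⟨j, hj'⟩, b) =
        (c.face (⟨j, hj⟩, b)).face (⟨i, hi'⟩, a) := by
      ext1
      · simp only [LatticeCube.face]; rw [add_right_comm]
      · simp only [LatticeCube.face]; rw [Finset.erase_right_comm]
    have hsign : c.faceSign (⟨i, hi⟩, a) * (c.face (⟨i, hi⟩, a)).faceSign (⟨j, hj'⟩, b) =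
        -(c.faceSign (⟨j, hj⟩, b) * (c.face (⟨j, hj⟩, b)).faceSign (⟨i, hi'⟩, a)) := by
      rcases lt_or_gt_of_ne hij with h | h
      · exact faceSign_swap c hi hj h a b hi' hj'
      · rw [faceSign_swap c hj hi h b a hj' hi', neg_neg]
    have key : ∀ (m n : ℤ) (x y z : ℤ) (t : TPlus), y ≤ x → z ≤ y →
        m • (Polynomial.X : Polynomial ℤ) ^ (x - y).toNat • n •
          (Polynomial.X : Polynomial ℤ) ^ (y - z).toNat • t =
        (m * n) • (Polynomial.X : Polynomial ℤ) ^ (x - z).toNat • t := by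
      intro m n x y z t hxy hyz
      rw [smul_comm _ n, ← mul_smul m n, ← mul_smul _ _ t, ← pow_add]
      congr 3
      omega
    dsimp only
    rw [key _ _ _ _ _ _ (c.weight_face_le w _) (LatticeCube.weight_face_le w _ _),
      key _ _ _ _ _ _ (c.weight_face_le w _) (LatticeCube.weight_face_le w _ _), hface, hsign,
      neg_smul, add_neg_cancel]
  · rintro ⟨⟨⟨j, hj⟩, b⟩, ⟨⟨i, hi'⟩, a⟩⟩ - - h
    have hij : i ≠ j := Finset.ne_of_mem_erase hi'
    apply hij
    have := congrArg (fun x => x.1.1.1) h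
    simpa using this
  · intro _ _; exact Finset.mem_univ _
  · rintro ⟨⟨⟨j, hj⟩, b⟩, ⟨⟨i, hi'⟩, a⟩⟩ -
    rfl

end Cohomology

/-! ### Plumbing graphs -/

/-- A plumbing graph whose plumbed 3-manifold is a rational homology sphere as soon as the graph is
negative definite: a tree (in particular connected and non-empty) with all genera zero and an integer
Euler decoration `e_v` at every vertex. -/
structure PlumbingGraph (V : Type*) where
  graph : SimpleGraph V
  isTree : graph.IsTree
  euler : V → ℤ

namespace PlumbingGraph

variable {V : Type*} [Fintype V] [DecidableEq V]

open Classical in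
/-- The intersection matrix `(E_v, E_w)` of the basis `{E_v}` of the lattice `L = ℤ^V`. -/
noncomputable def intersectionMatrix (G : PlumbingGraph V) : Matrix V V ℚ :=
  Matrix.of fun v w => if v = w then (G.euler v : ℚ) else if G.graph.Adj v w then 1 else 0

/-- The intersection form on `L ⊗ ℚ = ℚ^V`. -/
noncomputable def form (G : PlumbingGraph V) (x y : V → ℚ) : ℚ :=
  x ⬝ᵥ (G.intersectionMatrix.mulVec y)

/-- A lattice element `l ∈ L = ℤ^V` as an element of `L ⊗ ℚ = ℚ^V`. -/
def toRat {V : Type*} (l : V → ℤ) : V → ℚ := fun v => (l v : ℚ)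

/-- The graph is negative definite. -/
def IsNegDef (G : PlumbingGraph V) : Prop :=
  ∀ x : V → ℚ, x ≠ 0 → G.form x x < 0

/-- The dual lattice `L' = {l' ∈ L ⊗ ℚ : (l', L) ⊆ ℤ}`. -/
def dualLattice (G : PlumbingGraph V) : Set (V → ℚ) :=
  {l' | ∀ x : V → ℤ, ∃ m : ℤ, G.form l' (toRat x) = m}

/-- The characteristic elements: `k ∈ L'` with `(k, x) + (x, x) ∈ 2ℤ` for all `x ∈ L`. -/
def Char (G : PlumbingGraph V) : Set (V → ℚ) :=
  {k | k ∈ G.dualLattice ∧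
    ∀ x : V → ℤ, ∃ m : ℤ, G.form k (toRat x) + G.form (toRat x) (toRat x) = 2 * m}

/-- `χ_k(l) = -(l, l + k) / 2`. -/
noncomputable def chi (G : PlumbingGraph V) (k : V → ℚ) (l : V → ℤ) : ℚ :=
  -G.form (toRat l) (toRat l + k) / 2

theorem form_comm (G : PlumbingGraph V) (x y : V → ℚ) : G.form x y = G.form y x := by
  have hM : G.intersectionMatrix.transpose = G.intersectionMatrix := by
    ext v w
    by_cases h : v = w
    · subst h; rfl
    · have hadj : G.graph.Adj w v ↔ G.graph.Adj v w := G.graph.adj_comm w v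
      by_cases ha : G.graph.Adj v w
      · simp [intersectionMatrix, h, Ne.symm h, ha, hadj.2 ha]
      · simp [intersectionMatrix, h, Ne.symm h, ha, mt hadj.1 ha]
  unfold form
  rw [dotProduct_comm, ← Matrix.vecMul_transpose, hM, Matrix.dotProduct_mulVec]

/-- The weight function `w₀ = χ_k : L → ℤ`; for characteristic `k` the value of `χ_k` is an
integer, so taking the integer part changes nothing (see `weight_eq_chi`). -/
noncomputable def weight (G : PlumbingGraph V) (k : V → ℚ) (l : V → ℤ) : ℤ := ⌊G.chi k l⌋

theorem weight_eq_chi (G : PlumbingGraph V) {k : V → ℚ} (hk : k ∈ G.Char) (l : V → ℤ) :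
    (G.weight k l : ℚ) = G.chi k l := by
  obtain ⟨m, hm⟩ := hk.2 l
  have h : G.chi k l = ((-m : ℤ) : ℚ) := by
    have h1 : G.form (toRat l) (toRat l + k) = G.form (toRat l) (toRat l) + G.form k (toRat l) := by
      rw [G.form_comm k]
      simp only [form, Matrix.mulVec_add, dotProduct_add]
    rw [chi, h1, add_comm, hm]
    push_cast
    ring
  rw [weight, h, Int.floor_intCast]

/-- The canonical cycle `k_can ∈ L ⊗ ℚ`, the solution of the adjunction relations
`(k_can, E_j) = -(E_j, E_j) - 2` (see `form_canonicalCycle`). -/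
noncomputable def canonicalCycle (G : PlumbingGraph V) : V → ℚ :=
  (G.intersectionMatrix)⁻¹.mulVec fun j => -(G.euler j : ℚ) - 2

theorem form_canonicalCycle (G : PlumbingGraph V) (hG : G.IsNegDef) (j : V) :
    G.form G.canonicalCycle (Pi.single j 1) = -(G.euler j : ℚ) - 2 := by
  have hu : IsUnit G.intersectionMatrix.det := by
    rw [isUnit_iff_ne_zero]
    intro h0
    obtain ⟨x, hx, hx0⟩ := Matrix.exists_mulVec_eq_zero_iff.2 h0
    have := hG x hx
    simp [form, hx0] at this
  rw [form_comm, form, canonicalCycle, Matrix.mulVec_mulVec, Matrix.mul_nonsing_inv _ hu,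
    Matrix.one_mulVec, single_one_dotProduct]

/-- A (connected) negative definite graph is rational if `χ_can(l) > 0` for all `l ∈ L`, `l > 0`. -/
def IsRational (G : PlumbingGraph V) : Prop :=
  G.IsNegDef ∧ ∀ l : V → ℤ, 0 < l → 0 < G.chi G.canonicalCycle l

/-- The same tree with other Euler decorations. -/
def withEuler (G : PlumbingGraph V) (e : V → ℤ) : PlumbingGraph V := { G with euler := e }

/-- The graph has `ν` bad vertices: there is a set `J` of `ν` vertices such that replacing the
decorations `e_j`, `j ∈ J`, by some integers `e'_j ≤ e_j` gives a rational graph. -/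
def HasBadVertices (G : PlumbingGraph V) (ν : ℕ) : Prop :=
  ∃ J : Finset V, J.card = ν ∧ ∃ e' : V → ℤ,
    (∀ j ∈ J, e' j ≤ G.euler j) ∧ (∀ j ∉ J, e' j = G.euler j) ∧ (G.withEuler e').IsRational

end PlumbingGraph

/-- The lattice cohomology `ℍ^q(G, k)` of a plumbing graph, for a characteristic element `k`: the
lattice cohomology of `ℤ^V` with the weights defined by `w₀ = χ_k`. -/
abbrev PlumbingGraph.Cohomology {V : Type*} [Fintype V] [LinearOrder V] (G : PlumbingGraph V)
    (k : V → ℚ) (q : ℕ) : Type _ :=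
  LatticeCohomology (G.weight k) q

/-! Let `N` be the complement of the set `J` of bad vertices, and split the coboundary by
directions. For fixed `I ⊆ J` and fixed coordinates outside `N`, the cubes with transversal
directions `I` form a copy of the cubical complex of `ℤ^N`, in which a point `x` weighs as much as
the cube `(x, I)`.

The core is `collapsible_of_rational`: every finite box `[a, b]` in such a fiber shrinks to a point
by removing extremal layers along which the weight does not increase inwards. Since `w(x + E_v) -
w(x) = A_v - (E_v, x)` and the off-diagonal entries are non-negative, one extreme corner decides
whether a layer can go, or whether a direction of `I` can be dropped. If nothing can be removed and
`a ≠ b`, then `z = b - a + ∑_{j ∈ I} E_j` satisfies `(E_v, z) ≥ e_v + 2` on its support. On the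
support outside `N` the coefficient `z_v` is 1, so modifying `e_v` there leaves `(E_v, z) - e_v`
unchanged. This contradicts rationality of the modified graph, by `IsRational.exists_pairing_lt`.

A collapsible box has the cohomology of a point: cocycles of positive degree are exact
(`Collapsible.exists_primitive`), and those of degree zero are `U^(w - B₀) t` for a single `t`
(`Collapsible.exists_eq_smul`). The latter extend to larger boxes, so primitives on an exhaustion
can be made compatible, a Mittag-Leffler argument that gives `FibersCollapsible.exists_primitive`.

Finally the directions of `J` are added one by one. Each costs at most one degree
(`ExactInDegree.insert_of`), and the first costs none, because forward difference on `ℤ` is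
surjective (`FibersCollapsible.exists_partialD_eq`). Hence the cohomology vanishes in degrees at
least `|J|`. -/

namespace LatticeCochains

/-! ### The coboundary split by directions, on cochains of all degrees at once -/

section Differential

variable {V : Type*} [LinearOrder V] {M : Type*} [AddCommGroup M] {R : Type*} [CommRing R]
  [Module R M]

/-- The endpoint `l` (`false`) or `l + E_j` (`true`) of the edge in direction `j` starting at `l`. -/
def shift (l : V → ℤ) (j : V) (b : Bool) : V → ℤ := l + if b then Pi.single j 1 else 0

/-- The sign of the direction `j` in the oriented cube with directions `K`. -/
def dirSign (K : Finset V) (j : V) : ℤ := (-1) ^ (K.filter (· < j)).card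

/-- The sign of the upper and of the lower face. -/
def endSign (b : Bool) : ℤ := if b then 1 else -1

/-- The part in direction `j` of the weighted coboundary on all cubical cochains. -/
def partialD (u : R) (W : (V → ℤ) → Finset V → ℤ) (j : V) (φ : (V → ℤ) → Finset V → M) :
    (V → ℤ) → Finset V → M := fun l K =>
  if j ∈ K then
    ∑ b : Bool, (dirSign K j * endSign b) •
      u ^ (W l K - W (shift l j b) (K.erase j)).toNat • φ (shift l j b) (K.erase j)
  else 0

/-- The part in the directions `D` of the weighted coboundary. -/
def dirD (u : R) (W : (V → ℤ) → Finset V → ℤ) (D : Finset V) (φ : (V → ℤ) → Finset V → M) :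
    (V → ℤ) → Finset V → M := fun l K => ∑ j ∈ D, partialD u W j φ l K

/-- The weight of a face is at most the weight of the cube. -/
def FaceMonotone (W : (V → ℤ) → Finset V → ℤ) : Prop :=
  ∀ l K, ∀ j ∈ K, ∀ b, W (shift l j b) (K.erase j) ≤ W l K

theorem dirSign_mul_self (K : Finset V) (j : V) : dirSign K j * dirSign K j = 1 := by
  rw [dirSign, ← mul_pow]; simp

theorem endSign_mul_self (b : Bool) : endSign b * endSign b = 1 := by
  cases b <;> simp [endSign]

/-- Removing the smaller direction moves the larger one down by one position, while removing the
larger one does not affect the smaller. -/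
theorem dirSign_swap_of_lt {K : Finset V} {i j : V} (hi : i ∈ K) (hij : i < j) :
    dirSign K j * dirSign (K.erase j) i = -(dirSign K i * dirSign (K.erase i) j) := by
  simp only [dirSign]
  have h1 : (K.filter (· < j)).card = ((K.erase i).filter (· < j)).card + 1 := by
    rw [Finset.filter_erase, Finset.card_erase_add_one]
    simp [hi, hij]
  have h2 : (K.erase j).filter (· < i) = K.filter (· < i) := by
    rw [Finset.filter_erase, Finset.erase_eq_of_notMem]
    simp [hij.le]
  rw [h1, h2, pow_succ]
  ring

theorem dirSign_swap {K : Finset V} {i j : V} (hi : i ∈ K) (hj : j ∈ K) (hij : i ≠ j) :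
    dirSign K j * dirSign (K.erase j) i = -(dirSign K i * dirSign (K.erase i) j) := by
  rcases lt_or_gt_of_ne hij with h | h
  · exact dirSign_swap_of_lt hi h
  · rw [dirSign_swap_of_lt hj h, neg_neg]

theorem shift_comm (l : V → ℤ) (i j : V) (a b : Bool) :
    shift (shift l i a) j b = shift (shift l j b) i a := by
  simp only [shift]; rw [add_right_comm]

variable (u : R) (W : (V → ℤ) → Finset V → ℤ)

theorem partialD_congr {j : V} {φ ψ : (V → ℤ) → Finset V → M} {l : V → ℤ} {K : Finset V}
    (h : j ∈ K → ∀ b, φ (shift l j b) (K.erase j) = ψ (shift l j b) (K.erase j)) :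
    partialD u W j φ l K = partialD u W j ψ l K := by
  unfold partialD
  split_ifs with hj
  · exact Finset.sum_congr rfl fun b _ => by rw [h hj b]
  · rfl

theorem dirD_congr {D : Finset V} {φ ψ : (V → ℤ) → Finset V → M} {l : V → ℤ} {K : Finset V}
    (h : ∀ j ∈ D, j ∈ K → ∀ b, φ (shift l j b) (K.erase j) = ψ (shift l j b) (K.erase j)) :
    dirD u W D φ l K = dirD u W D ψ l K :=
  Finset.sum_congr rfl fun j hj => partialD_congr u W (h j hj)

theorem partialD_zero (j : V) : partialD u W j (0 : (V → ℤ) → Finset V → M) = 0 := by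
  funext l K; simp [partialD]

theorem dirD_zero (D : Finset V) : dirD u W D (0 : (V → ℤ) → Finset V → M) = 0 := by
  funext l K; simp [dirD, partialD_zero]

theorem partialD_add (j : V) (φ ψ : (V → ℤ) → Finset V → M) :
    partialD u W j (φ + ψ) = partialD u W j φ + partialD u W j ψ := by
  funext l K
  simp only [partialD, Pi.add_apply]
  split_ifs
  · simp [smul_add, Finset.sum_add_distrib]
  · simp

theorem dirD_add (D : Finset V) (φ ψ : (V → ℤ) → Finset V → M) :
    dirD u W D (φ + ψ) = dirD u W D φ + dirD u W D ψ := by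
  funext l K
  simp [dirD, partialD_add, Finset.sum_add_distrib]

theorem dirD_neg (D : Finset V) (φ : (V → ℤ) → Finset V → M) :
    dirD u W D (-φ) = -dirD u W D φ := by
  rw [eq_neg_iff_add_eq_zero, ← dirD_add, neg_add_cancel, dirD_zero]

theorem dirD_sub (D : Finset V) (φ ψ : (V → ℤ) → Finset V → M) :
    dirD u W D (φ - ψ) = dirD u W D φ - dirD u W D ψ := by
  rw [sub_eq_add_neg, dirD_add, dirD_neg, ← sub_eq_add_neg]

theorem partialD_of_notMem {j : V} (φ : (V → ℤ) → Finset V → M) (l : V → ℤ) {K : Finset V}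
    (h : j ∉ K) : partialD u W j φ l K = 0 := if_neg h

theorem partialD_eq_zero {j : V} {φ : (V → ℤ) → Finset V → M} {l : V → ℤ} {K : Finset V}
    (h : j ∈ K → ∀ b, φ (shift l j b) (K.erase j) = 0) : partialD u W j φ l K = 0 := by
  rw [partialD_congr (ψ := 0) u W (by simpa using h), partialD_zero]; rfl

theorem dirD_eq_zero {D : Finset V} {φ : (V → ℤ) → Finset V → M} {l : V → ℤ} {K : Finset V}
    (h : ∀ j ∈ D, j ∈ K → ∀ b, φ (shift l j b) (K.erase j) = 0) : dirD u W D φ l K = 0 :=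
  Finset.sum_eq_zero fun j hj => partialD_eq_zero u W (h j hj)

theorem dirD_insert {D : Finset V} {j : V} (hj : j ∉ D) (φ : (V → ℤ) → Finset V → M) :
    dirD u W (insert j D) φ = partialD u W j φ + dirD u W D φ := by
  funext l K
  simp [dirD, Finset.sum_insert hj]

variable {W}

/-- Truncated exponents add only along a decreasing chain of weights; this is where monotonicity
under passage to faces is used. -/
theorem smul_pow_toNat_comp {x y z : ℤ} (hxy : y ≤ x) (hyz : z ≤ y) (t : M) :
    u ^ (x - y).toNat • u ^ (y - z).toNat • t = u ^ (x - z).toNat • t := by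
  rw [← mul_smul, ← pow_add]
  congr 2
  omega

theorem partialD_self (j : V) (φ : (V → ℤ) → Finset V → M) :
    partialD u W j (partialD u W j φ) = 0 := by
  funext l K
  exact partialD_eq_zero u W fun _ b => partialD_of_notMem u W _ _ (Finset.notMem_erase j K)

theorem partialD_anticomm (hW : FaceMonotone W) {i j : V} (hij : i ≠ j)
    (φ : (V → ℤ) → Finset V → M) :
    partialD u W i (partialD u W j φ) = -partialD u W j (partialD u W i φ) := by
  funext l K
  by_cases hi : i ∈ K
  swap
  · rw [partialD_of_notMem u W _ _ hi, Pi.neg_apply, Pi.neg_apply, eq_comm, neg_eq_zero]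
    exact partialD_eq_zero u W fun _ b => partialD_of_notMem u W _ _ (by simp [hi])
  by_cases hj : j ∈ K
  swap
  · rw [Pi.neg_apply, Pi.neg_apply, partialD_of_notMem u W _ _ hj, neg_zero]
    exact partialD_eq_zero u W fun _ b => partialD_of_notMem u W _ _ (by simp [hj])
  have hi' : i ∈ K.erase j := Finset.mem_erase.2 ⟨hij, hi⟩
  have hj' : j ∈ K.erase i := Finset.mem_erase.2 ⟨hij.symm, hj⟩
  have expand : ∀ {i j : V} (_ : i ∈ K) (_ : j ∈ K.erase i),
      partialD u W i (partialD u W j φ) l K = ∑ a : Bool, ∑ b : Bool,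
        (dirSign K i * dirSign (K.erase i) j * (endSign a * endSign b)) •
        u ^ (W l K - W (shift (shift l i a) j b) ((K.erase i).erase j)).toNat •
        φ (shift (shift l i a) j b) ((K.erase i).erase j) := by
    intro i j hi hj'
    rw [partialD, if_pos hi]
    refine Finset.sum_congr rfl fun a _ => ?_
    rw [partialD, if_pos hj', Finset.smul_sum, Finset.smul_sum]
    refine Finset.sum_congr rfl fun b _ => ?_
    rw [smul_comm (u ^ _) (dirSign (K.erase i) j * endSign b), smul_smul,
      smul_pow_toNat_comp u (hW _ _ _ hi _) (hW _ _ _ hj' _)]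
    congr 1
    ring
  rw [Pi.neg_apply, Pi.neg_apply, expand hi hj', expand hj hi', Finset.sum_comm,
    ← Finset.sum_neg_distrib]
  refine Finset.sum_congr rfl fun b _ => ?_
  rw [← Finset.sum_neg_distrib]
  refine Finset.sum_congr rfl fun a _ => ?_
  rw [shift_comm, Finset.erase_right_comm, dirSign_swap hj hi hij.symm, ← neg_smul]
  congr 1
  ring

/-- The partial coboundaries square to zero and anticommute, so every subset of directions has its
own complex. This freedom in `D` allows the directions to be added one at a time. -/
theorem dirD_dirD (hW : FaceMonotone W) (D : Finset V) (φ : (V → ℤ) → Finset V → M) :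
    dirD u W D (dirD u W D φ) = 0 := by
  have hlin : ∀ (i : V) (s : Finset V), partialD u W i (dirD u W s φ) =
      ∑ j ∈ s, partialD u W i (partialD u W j φ) := by
    intro i s
    induction s using Finset.induction_on with
    | empty => exact partialD_zero u W i
    | insert j s hj ih => rw [dirD_insert u W hj, partialD_add, ih, Finset.sum_insert hj]
  induction D using Finset.induction_on with
  | empty => rfl
  | insert j s hj ih =>
    have hsum : ∀ ψ : (V → ℤ) → Finset V → M, dirD u W s ψ = ∑ i ∈ s, partialD u W i ψ := by
      intro ψ; funext l K; simp [dirD]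
    rw [dirD_insert u W hj, dirD_insert u W hj, dirD_add, ih, partialD_add, partialD_self,
      zero_add, add_zero, hlin, hsum, ← Finset.sum_add_distrib]
    refine Finset.sum_eq_zero fun i hi => ?_
    rw [partialD_anticomm u hW (by rintro rfl; exact hj hi), neg_add_cancel]

end Differential

/-! ### Weights of cubes -/

section CubeWeight

variable {V : Type*} [DecidableEq V]

/-- The sum `∑_{j ∈ S} E_j`. -/
def vertexVec (S : Finset V) : V → ℤ := ∑ j ∈ S, Pi.single j 1

theorem vertexVec_apply (S : Finset V) (x : V) : vertexVec S x = if x ∈ S then 1 else 0 := by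
  simp [vertexVec, Finset.sum_apply, Pi.single_apply]

theorem vertexVec_empty : vertexVec (∅ : Finset V) = 0 := rfl

theorem vertexVec_insert {S : Finset V} {j : V} (h : j ∉ S) :
    vertexVec (insert j S) = Pi.single j 1 + vertexVec S := Finset.sum_insert h

theorem vertexVec_mono {S T : Finset V} (h : S ⊆ T) : vertexVec S ≤ vertexVec T := by
  intro x
  rw [vertexVec_apply, vertexVec_apply]
  by_cases hx : x ∈ S
  · simp [hx, h hx]
  · rw [if_neg hx]; split_ifs <;> simp

/-- The maximum of the weights of the vertices of the cube `(l, K)`. -/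
def cubeWeight (w : (V → ℤ) → ℤ) (l : V → ℤ) (K : Finset V) : ℤ :=
  K.powerset.sup' (Finset.powerset_nonempty K) fun S => w (l + vertexVec S)

variable (w : (V → ℤ) → ℤ)

theorem cubeWeight_le_iff {l : V → ℤ} {K : Finset V} {C : ℤ} :
    cubeWeight w l K ≤ C ↔ ∀ S ⊆ K, w (l + vertexVec S) ≤ C := by
  rw [cubeWeight, Finset.sup'_le_iff]; simp only [Finset.mem_powerset]

theorem le_cubeWeight (l : V → ℤ) {K S : Finset V} (h : S ⊆ K) :
    w (l + vertexVec S) ≤ cubeWeight w l K := (cubeWeight_le_iff w).1 le_rfl S h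

theorem cubeWeight_insert_le_iff {l : V → ℤ} {K : Finset V} {v : V} (hv : v ∉ K) {C : ℤ} :
    cubeWeight w l (insert v K) ≤ C ↔
      cubeWeight w l K ≤ C ∧ cubeWeight w (l + Pi.single v 1) K ≤ C := by
  simp only [cubeWeight_le_iff]
  constructor
  · intro h
    refine ⟨fun S hS => h S (hS.trans (Finset.subset_insert _ _)), fun S hS => ?_⟩
    have := h (insert v S) (Finset.insert_subset_insert v hS)
    rwa [vertexVec_insert (fun h => hv (hS h)), ← add_assoc] at this
  · rintro ⟨h1, h2⟩ S hS
    by_cases hvS : v ∈ S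
    · have := h2 (S.erase v) (by rwa [← Finset.subset_insert_iff])
      rwa [add_assoc, ← vertexVec_insert (Finset.notMem_erase v S),
        Finset.insert_erase hvS] at this
    · exact h1 S ((Finset.subset_insert_iff_of_notMem hvS).1 hS)

/-- Comparison of the weights of two parallel cubes, from the weights of their faces in the
directions outside `N`. -/
theorem cubeWeight_le_cubeWeight {N K : Finset V} {l l' : V → ℤ}
    (h : ∀ S ⊆ K ∩ N,
      cubeWeight w (l' + vertexVec S) (K \ N) ≤ cubeWeight w (l + vertexVec S) (K \ N)) :
    cubeWeight w l' K ≤ cubeWeight w l K := by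
  have key : ∀ (l : V → ℤ) (S T : Finset V), S ⊆ N → Disjoint T N →
      l + vertexVec S + vertexVec T = l + vertexVec (S ∪ T) := by
    intro l S T hS hT
    have : Disjoint S T := (hT.mono_right hS).symm
    rw [add_assoc, vertexVec, vertexVec, vertexVec, Finset.sum_union this]
  rw [cubeWeight_le_iff]
  intro S hS
  -- A vertex of the cube is reached first along `N`, then inside the transversal face, where the
  -- hypothesis applies.
  have e : (S ∩ N) ∪ (S \ N) = S := by rw [Finset.union_comm]; exact Finset.sdiff_union_inter S N
  rw [← e, ← key _ _ _ Finset.inter_subset_right Finset.sdiff_disjoint]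
  refine (le_cubeWeight w _ (Finset.sdiff_subset_sdiff hS subset_rfl)).trans
    ((h _ (Finset.inter_subset_inter_right hS)).trans ?_)
  rw [cubeWeight_le_iff]
  intro T hT
  rw [key _ _ _ Finset.inter_subset_right
    (Finset.sdiff_disjoint.mono_left hT)]
  exact le_cubeWeight w _ (Finset.union_subset (Finset.inter_subset_left.trans hS)
    (hT.trans Finset.sdiff_subset))

end CubeWeight

/-! ### Elementary expansions and extension of primitives -/

section Collapse

variable {V : Type*} [LinearOrder V]

theorem shift_false (l : V → ℤ) (j : V) : shift l j false = l := by simp [shift]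

theorem shift_true (l : V → ℤ) (j : V) : shift l j true = l + Pi.single j 1 := by simp [shift]

theorem faceMonotone_cubeWeight (w : (V → ℤ) → ℤ) : FaceMonotone (cubeWeight w) := by
  intro l K j hj b
  have h := (cubeWeight_insert_le_iff w (l := l) (Finset.notMem_erase j K) (C := _)).1 le_rfl
  rw [Finset.insert_erase hj] at h
  cases b
  · rw [shift_false]; exact h.1
  · rw [shift_true]; exact h.2

/-- If the far face of a cube in direction `v` weighs at most as much as the near face, then the cube
weighs as much as the near face. -/
theorem cubeWeight_insert_eq (w : (V → ℤ) → ℤ) {N K : Finset V} {l : V → ℤ} {v : V} (hv : v ∉ K)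
    (t : Bool) (h : ∀ S ⊆ K ∩ N, cubeWeight w (shift l v (!t) + vertexVec S) (K \ N) ≤
      cubeWeight w (shift l v t + vertexVec S) (K \ N)) :
    cubeWeight w l (insert v K) = cubeWeight w (shift l v t) K := by
  have h' := cubeWeight_le_cubeWeight w h
  apply le_antisymm
  · rw [cubeWeight_insert_le_iff w hv]
    cases t <;> simp only [Bool.not_true, Bool.not_false, shift_true, shift_false] at h' ⊢ <;>
      exact ⟨by first | exact le_rfl | exact h', by first | exact le_rfl | exact h'⟩
  · have := faceMonotone_cubeWeight w l (insert v K) v (Finset.mem_insert_self _ _) t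
    rwa [Finset.erase_insert hv] at this

/-- A box `[a, b]` is collapsible with respect to the weight `F` on lattice points if it can be shrunk
to a point by repeatedly removing an extremal layer all of whose points weigh at least as much as
their neighbours in the next layer. -/
inductive Collapsible (F : (V → ℤ) → ℤ) : (V → ℤ) → (V → ℤ) → Prop
  | point (a : V → ℤ) : Collapsible F a a
  | top {a b : V → ℤ} (v : V) (hv : a v < b v)
      (h : ∀ x, a ≤ x → x ≤ b → x v = b v → F (x - Pi.single v 1) ≤ F x)
      (ih : Collapsible F a (b - Pi.single v 1)) : Collapsible F a b
  | bot {a b : V → ℤ} (v : V) (hv : a v < b v)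
      (h : ∀ x, a ≤ x → x ≤ b → x v = a v → F (x + Pi.single v 1) ≤ F x)
      (ih : Collapsible F (a + Pi.single v 1) b) : Collapsible F a b

/-- The cubes `(l, L)` with `L \ N = I` whose projection to the directions `N` lies in `[a, b]`. -/
def InBox (N I : Finset V) (a b : V → ℤ) (l : V → ℤ) (L : Finset V) : Prop :=
  L \ N = I ∧ (∀ x, a x ≤ l x) ∧ ∀ x, l x + (if x ∈ L ∧ x ∈ N then 1 else 0) ≤ b x

/-- The family `B` of cubes arises from `A` by adding pairs of a cube having the direction `v` and its
face with index `t` in the direction `v`, both of the same weight. -/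
structure IsExpansion (N : Finset V) (W : (V → ℤ) → Finset V → ℤ) (v : V) (t : Bool)
    (A B : (V → ℤ) → Finset V → Prop) : Prop where
  mem : v ∈ N
  face : ∀ l L, A l L → ∀ j ∈ N, j ∈ L → ∀ b, A (shift l j b) (L.erase j)
  thick : ∀ l L, B l L → ¬A l L → v ∉ L → ∃ l', shift l' v t = l ∧ B l' (insert v L) ∧
    ¬A l' (insert v L)
  near : ∀ l L, B l L → ¬A l L → v ∈ L → ¬A (shift l v t) (L.erase v) ∧
    A (shift l v (!t)) (L.erase v) ∧ W l L = W (shift l v t) (L.erase v)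
  side : ∀ l L, B l L → ¬A l L → v ∈ L → ∀ j ∈ N, j ∈ L → j ≠ v → ∀ b,
    B (shift l j b) (L.erase j) ∧ ¬A (shift l j b) (L.erase j)

variable {M : Type*} [AddCommGroup M] {R : Type*} [CommRing R] [Module R M] (u : R)

open Classical in
/-- Primitives of cocycles extend along expansions. -/
theorem IsExpansion.exists_primitive {N : Finset V} {W : (V → ℤ) → Finset V → ℤ}
    (hW : FaceMonotone W) {v : V} {t : Bool}
    {A B : (V → ℤ) → Finset V → Prop} (hE : IsExpansion N W v t A B)
    {φ : (V → ℤ) → Finset V → M} (hφ : ∀ l L, B l L → dirD u W N φ l L = 0)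
    (hA : ∃ ψ, ∀ l L, A l L → dirD u W N ψ l L = φ l L) :
    ∃ ψ, ∀ l L, B l L → dirD u W N ψ l L = φ l L := by
  obtain ⟨ψ, hψ⟩ := hA
  -- If `η` vanishes on the new cubes with direction `v`, only the two faces in direction `v`
  -- contribute, and the near face has coefficient `±1` because it weighs as much as the cube.
  have hnear : ∀ (η : (V → ℤ) → Finset V → M) (l : V → ℤ) (L : Finset V), B l L → ¬A l L →
      v ∈ L → (∀ l' L', B l' L' → ¬A l' L' → v ∈ L' → η l' L' = 0) →
      dirD u W N η l L = (dirSign L v * endSign t) • (η (shift l v t) (L.erase v) -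
        u ^ (W l L - W (shift l v (!t)) (L.erase v)).toNat • η (shift l v (!t)) (L.erase v)) := by
    intro η l L hB hnA hv h0
    rw [dirD, Finset.sum_eq_single_of_mem v hE.mem]
    · rw [partialD, if_pos hv, Fintype.sum_bool]
      have := (hE.near l L hB hnA hv).2.2
      cases t <;> simp [this, endSign, smul_sub] <;> abel
    · intro j hj hjv
      refine partialD_eq_zero u W fun hjL b => ?_
      obtain ⟨h1, h2⟩ := hE.side l L hB hnA hv j hj hjL hjv b
      exact h0 _ _ h1 h2 (Finset.mem_erase.2 ⟨hjv.symm, hv⟩)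
  -- The old values are kept, new cubes with direction `v` get 0, and the value on each near face is
  -- forced by the equation on the cube that it is matched with.
  let ψ' : (V → ℤ) → Finset V → M := fun l L =>
    if A l L then ψ l L else if v ∈ L then 0 else
      let l' := l - if t then Pi.single v 1 else 0
      (dirSign (insert v L) v * endSign t) • φ l' (insert v L) +
        u ^ (W l' (insert v L) - W (shift l' v (!t)) L).toNat • ψ (shift l' v (!t)) L
  have hA' : ∀ l L, A l L → dirD u W N ψ' l L = φ l L := by
    intro l L h
    rw [← hψ l L h]
    exact dirD_congr u W fun j hj hjL b => if_pos (hE.face l L h j hj hjL b)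
  have hV' : ∀ l L, B l L → ¬A l L → v ∈ L → dirD u W N ψ' l L = φ l L := by
    intro l L hB hnA hv
    rw [hnear ψ' l L hB hnA hv fun l' L' _ h2 h3 => by simp only [ψ', if_neg h2, if_pos h3]]
    obtain ⟨h1, h2, -⟩ := hE.near l L hB hnA hv
    have hs : shift l v t - (if t then Pi.single v 1 else 0) = l := add_sub_cancel_right _ _
    simp only [ψ', if_neg h1, if_pos h2, if_neg (Finset.notMem_erase v L), hs,
      Finset.insert_erase hv, add_sub_cancel_right]
    rw [smul_smul, mul_mul_mul_comm, dirSign_mul_self, endSign_mul_self, one_mul, one_smul]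
  refine ⟨ψ', fun l L hB => ?_⟩
  by_cases hA : A l L
  · exact hA' l L hA
  by_cases hv : v ∈ L
  · exact hV' l L hB hA hv
  obtain ⟨l', rfl, hB', hnA'⟩ := hE.thick l L hB hA hv
  -- The error `φ - dψ'` is closed on the matched cube and vanishes on the far face, so the unit
  -- coefficient of the near face makes it vanish there too.
  have hη := hnear (φ - dirD u W N ψ') l' (insert v L) hB' hnA' (Finset.mem_insert_self _ _)
    fun l' L' h1 h2 h3 => by simp [hV' l' L' h1 h2 h3]
  rw [dirD_sub, dirD_dirD u hW, sub_zero, hφ _ _ hB', Finset.erase_insert hv] at hη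
  have hfar := (hE.near l' _ hB' hnA' (Finset.mem_insert_self _ _)).2.1
  rw [Finset.erase_insert hv] at hfar
  simp only [Pi.sub_apply, hA' _ _ hfar, sub_self, smul_zero, sub_zero] at hη
  have := congrArg (fun m => (dirSign (insert v L) v * endSign t) • m) hη
  simp only [smul_zero] at this
  rw [smul_smul, mul_mul_mul_comm, dirSign_mul_self, endSign_mul_self, one_mul, one_smul] at this
  exact (sub_eq_zero.1 this.symm).symm

end Collapse

/-! ### Cohomology of a collapsible box -/

section Box

variable {V : Type*} [LinearOrder V] {N I : Finset V} {a b : V → ℤ}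

theorem shift_apply (l : V → ℤ) (j : V) (t : Bool) (x : V) :
    shift l j t x = l x + if t = true ∧ x = j then 1 else 0 := by
  cases t <;> simp [shift, Pi.single_apply]

theorem InBox.face {l : V → ℤ} {L : Finset V} (h : InBox N I a b l L) {j : V} (hj : j ∈ N)
    (hjL : j ∈ L) (t : Bool) : InBox N I a b (shift l j t) (L.erase j) := by
  obtain ⟨h1, h2, h3⟩ := h
  refine ⟨?_, fun x => ?_, fun x => ?_⟩
  · rw [Finset.erase_sdiff_comm, Finset.erase_eq_of_notMem (by simp [hj]), h1]
  · rw [shift_apply]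
    have := h2 x
    split_ifs <;> omega
  · have := h3 x
    rw [shift_apply]
    by_cases hx : x = j
    · subst hx
      simp only [hjL, hj, and_self, if_true] at this
      simp only [Finset.notMem_erase, false_and, if_false]
      split_ifs <;> omega
    · simpa [hx] using this

theorem InBox.mem_Icc_of_subset {l : V → ℤ} {L S : Finset V} (h : InBox N I a b l L)
    (hS : S ⊆ L ∩ N) : a ≤ l + vertexVec S ∧ l + vertexVec S ≤ b := by
  obtain ⟨-, h2, h3⟩ := h
  constructor <;> intro x <;> have h2 := h2 x <;> have h3 := h3 x <;>
    simp only [Pi.add_apply, vertexVec_apply]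
  · split_ifs <;> omega
  · by_cases hx : x ∈ S
    · simp only [Finset.mem_inter.1 (hS hx), and_self, if_true] at h3
      simpa [hx] using h3
    · simp only [if_neg hx]
      split_ifs at h3 <;> omega

/-- The new cubes are those touching the layer `x v = b v`. The ones lying in the layer are the
upper faces of the ones ending on it, and the weights of the pair agree because the weight does not
increase inwards. -/
theorem isExpansion_top (w : (V → ℤ) → ℤ) {v : V} (hvN : v ∈ N) (hv : a v < b v)
    (h : ∀ x, a ≤ x → x ≤ b → x v = b v →
      cubeWeight w (x - Pi.single v 1) I ≤ cubeWeight w x I) :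
    IsExpansion N (cubeWeight w) v true (InBox N I a (b - Pi.single v 1)) (InBox N I a b) := by
  have top : ∀ l L, InBox N I a b l L → ¬InBox N I a (b - Pi.single v 1) l L →
      l v + (if v ∈ L then 1 else 0) = b v := by
    intro l L ⟨h1, h2, h3⟩ hA
    by_contra hne
    refine hA ⟨h1, h2, fun x => ?_⟩
    have h3x := h3 x
    by_cases hx : x = v
    · subst hx
      simp only [hvN, and_true] at h3x ⊢
      simp only [Pi.sub_apply, Pi.single_eq_same]
      omega
    · simpa [hx] using h3x
  have notA : ∀ l L, l v + (if v ∈ L then 1 else 0) = b v →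
      ¬InBox N I a (b - Pi.single v 1) l L := by
    rintro l L he ⟨-, -, h3⟩
    have := h3 v
    simp only [hvN, and_true, Pi.sub_apply, Pi.single_eq_same] at this
    omega
  refine ⟨hvN, fun l L h j hj hjL t => h.face hj hjL t, ?_, ?_, ?_⟩
  · intro l L hB hA hvL
    have ht := top l L hB hA
    rw [if_neg hvL, add_zero] at ht
    obtain ⟨h1, h2, h3⟩ := hB
    refine ⟨l - Pi.single v 1, by simp [shift_true], ⟨?_, fun x => ?_, fun x => ?_⟩, ?_⟩
    · rw [Finset.insert_sdiff_of_mem _ hvN, h1]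
    · have := h2 x
      by_cases hx : x = v
      · subst hx; simp only [Pi.sub_apply, Pi.single_eq_same]; omega
      · simpa [hx] using this
    · have := h3 x
      by_cases hx : x = v
      · subst hx; simp [hvN]; omega
      · simpa [hx] using this
    · exact notA _ _ (by simp [ht])
  · intro l L hB hA hvL
    have ht := top l L hB hA
    rw [if_pos hvL] at ht
    refine ⟨notA _ _ (by simp [shift_apply, ht]), ?_, ?_⟩
    · obtain ⟨h1, h2, h3⟩ := hB.face hvN hvL false
      refine ⟨h1, h2, fun x => ?_⟩
      have := h3 x
      by_cases hx : x = v
      · subst hx; simp [shift_false]; omega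
      · simpa [hx] using this
    · conv_lhs => rw [← Finset.insert_erase hvL]
      refine cubeWeight_insert_eq w (N := N) (Finset.notMem_erase v L) true fun S hS => ?_
      have hI : L.erase v \ N = I := (hB.face hvN hvL true).1
      have hm := (hB.face hvN hvL true).mem_Icc_of_subset hS
      rw [hI]
      have hvS : v ∉ S := fun hh => by simpa using hS hh
      have := h _ hm.1 hm.2 (by simp [shift_apply, vertexVec_apply, hvS, ht])
      convert this using 2
      simp only [shift_true, Bool.not_true, shift_false]
      abel
  · intro l L hB hA hvL j hj hjL hjv t
    have ht := top l L hB hA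
    rw [if_pos hvL] at ht
    refine ⟨hB.face hj hjL t, notA _ _ ?_⟩
    simp [shift_apply, hjv.symm, hvL, ht]

/-- Mirror image of `isExpansion_top`: a new cube is recognised by its corner lying in the layer,
and the near face is now the lower one. -/
theorem isExpansion_bot (w : (V → ℤ) → ℤ) {v : V} (hvN : v ∈ N) (hv : a v < b v)
    (h : ∀ x, a ≤ x → x ≤ b → x v = a v →
      cubeWeight w (x + Pi.single v 1) I ≤ cubeWeight w x I) :
    IsExpansion N (cubeWeight w) v false (InBox N I (a + Pi.single v 1) b) (InBox N I a b) := by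
  have bot : ∀ l L, InBox N I a b l L → ¬InBox N I (a + Pi.single v 1) b l L → l v = a v := by
    intro l L ⟨h1, h2, h3⟩ hA
    by_contra hne
    refine hA ⟨h1, fun x => ?_, h3⟩
    have h2x := h2 x
    by_cases hx : x = v
    · subst hx
      simp only [Pi.add_apply, Pi.single_eq_same]
      omega
    · simpa [hx] using h2x
  have notA : ∀ l L, l v = a v → ¬InBox N I (a + Pi.single v 1) b l L := by
    rintro l L he ⟨-, h2, -⟩
    have := h2 v
    simp only [Pi.add_apply, Pi.single_eq_same] at this
    omega
  refine ⟨hvN, fun l L h j hj hjL t => h.face hj hjL t, ?_, ?_, ?_⟩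
  · intro l L hB hA hvL
    have ht := bot l L hB hA
    obtain ⟨h1, h2, h3⟩ := hB
    refine ⟨l, shift_false _ _, ⟨?_, h2, fun x => ?_⟩, notA _ _ ht⟩
    · rw [Finset.insert_sdiff_of_mem _ hvN, h1]
    · have := h3 x
      by_cases hx : x = v
      · subst hx; simp [hvN]; omega
      · simpa [hx] using this
  · intro l L hB hA hvL
    have ht := bot l L hB hA
    refine ⟨notA _ _ (by simp [shift_apply, ht]), ?_, ?_⟩
    · obtain ⟨h1, h2, h3⟩ := hB.face hvN hvL true
      refine ⟨h1, fun x => ?_, h3⟩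
      have := h2 x
      by_cases hx : x = v
      · subst hx; simp [shift_apply]; omega
      · simpa [hx] using this
    · conv_lhs => rw [← Finset.insert_erase hvL]
      refine cubeWeight_insert_eq w (N := N) (Finset.notMem_erase v L) false fun S hS => ?_
      have hI : L.erase v \ N = I := (hB.face hvN hvL false).1
      have hm := (hB.face hvN hvL false).mem_Icc_of_subset hS
      rw [hI]
      have hvS : v ∉ S := fun hh => by simpa using hS hh
      have := h _ hm.1 hm.2 (by simp [shift_apply, vertexVec_apply, hvS, ht])
      convert this using 2
      simp only [shift_true, Bool.not_false, shift_false]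
      abel
  · intro l L hB hA hvL j hj hjL hjv t
    exact ⟨hB.face hj hjL t, notA _ _ (by simp [shift_apply, hjv.symm, bot l L hB hA])⟩

variable {M : Type*} [AddCommGroup M] {R : Type*} [CommRing R] [Module R M] (u : R)
  (w : (V → ℤ) → ℤ)

/-- On a collapsible box cocycles of positive degree have primitives. -/
theorem Collapsible.exists_primitive (hC : Collapsible (fun x => cubeWeight w x I) a b)
    (hab : ∀ x, x ∉ N → a x = b x) {φ : (V → ℤ) → Finset V → M}
    (hφ : ∀ l L, InBox N I a b l L → dirD u (cubeWeight w) N φ l L = 0)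
    (h0 : ∀ l L, L ∩ N = ∅ → φ l L = 0) :
    ∃ ψ, ∀ l L, InBox N I a b l L → dirD u (cubeWeight w) N ψ l L = φ l L := by
  induction hC with
  | point a =>
    refine ⟨0, fun l L ⟨h1, h2, h3⟩ => ?_⟩
    have : L ∩ N = ∅ := by
      ext x
      simp only [Finset.mem_inter, Finset.notMem_empty, iff_false]
      intro hx
      have := h2 x
      have := h3 x
      rw [if_pos hx] at this
      omega
    rw [h0 l L this, dirD_zero]; rfl
  | @top a b v hv h ih hrec =>
    have hvN : v ∈ N := by by_contra hvN; exact hv.ne (hab v hvN)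
    have hE := isExpansion_top w hvN hv h
    refine hE.exists_primitive u (faceMonotone_cubeWeight w) hφ (hrec (fun x hx => ?_) ?_)
    · have : x ≠ v := by rintro rfl; exact hx hvN
      simp [this, hab x hx]
    · intro l L ⟨h1, h2, h3⟩
      exact hφ l L ⟨h1, h2, fun x => (h3 x).trans (by
        simp only [Pi.sub_apply, Pi.single_apply]; split_ifs <;> omega)⟩
  | @bot a b v hv h ih hrec =>
    have hvN : v ∈ N := by by_contra hvN; exact hv.ne (hab v hvN)
    have hE := isExpansion_bot w hvN hv h
    refine hE.exists_primitive u (faceMonotone_cubeWeight w) hφ (hrec (fun x hx => ?_) ?_)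
    · have : x ≠ v := by rintro rfl; exact hx hvN
      simp [this, hab x hx]
    · intro l L ⟨h1, h2, h3⟩
      exact hφ l L ⟨h1, fun x => le_trans (by
        simp only [Pi.add_apply, Pi.single_apply]; split_ifs <;> omega) (h2 x), h3⟩

/-- The differential of a cochain on an edge. -/
theorem dirD_edge {W : (V → ℤ) → Finset V → ℤ} {v : V} (hvN : v ∈ N) (hI : Disjoint I N)
    (φ : (V → ℤ) → Finset V → M) (l : V → ℤ) :
    dirD u W N φ l (insert v I) = dirSign (insert v I) v •
      (u ^ (W l (insert v I) - W (l + Pi.single v 1) I).toNat • φ (l + Pi.single v 1) I -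
        u ^ (W l (insert v I) - W l I).toNat • φ l I) := by
  have hvI : v ∉ I := fun h => Finset.disjoint_left.1 hI h hvN
  rw [dirD, Finset.sum_eq_single_of_mem v hvN]
  · rw [partialD, if_pos (Finset.mem_insert_self _ _), Fintype.sum_bool]
    simp [endSign, shift_true, shift_false, Finset.erase_insert hvI, sub_eq_add_neg]
  · intro j hj hjv
    refine partialD_of_notMem u W _ _ fun h => ?_
    rcases Finset.mem_insert.1 h with h | h
    · exact hjv h
    · exact Finset.disjoint_left.1 hI h hj

theorem dirD_edge_eq_zero {W : (V → ℤ) → Finset V → ℤ} {v : V} (hvN : v ∈ N) (hI : Disjoint I N)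
    (φ : (V → ℤ) → Finset V → M) (l : V → ℤ) :
    dirD u W N φ l (insert v I) = 0 ↔
      u ^ (W l (insert v I) - W (l + Pi.single v 1) I).toNat • φ (l + Pi.single v 1) I =
        u ^ (W l (insert v I) - W l I).toNat • φ l I := by
  rw [dirD_edge u hvN hI, ← sub_eq_zero (a := u ^ _ • φ _ I)]
  constructor
  · intro h
    have := congrArg (fun m => dirSign (insert v I) v • m) h
    simpa [smul_smul, dirSign_mul_self] using this
  · intro h; rw [h, smul_zero]

theorem exists_pow_smul_eq (hu : ∀ m : M, ∃ m', u • m' = m) (n : ℕ) (m : M) :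
    ∃ m', u ^ n • m' = m := by
  induction n generalizing m with
  | zero => exact ⟨m, by simp⟩
  | succ n ih =>
    obtain ⟨m₁, h₁⟩ := hu m
    obtain ⟨m₂, h₂⟩ := ih m₁
    exact ⟨m₂, by rw [pow_succ', mul_smul, h₂, h₁]⟩

/-- On a collapsible box the cocycles of degree zero are standard. -/
theorem Collapsible.exists_eq_smul (hC : Collapsible (fun x => cubeWeight w x I) a b)
    (hab : ∀ x, x ∉ N → a x = b x) (hI : Disjoint I N) (hu : ∀ m : M, ∃ m', u • m' = m)
    {B₀ : ℤ} (hB : ∀ l, B₀ ≤ cubeWeight w l I) {φ : (V → ℤ) → Finset V → M}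
    (hφ : ∀ l L, InBox N I a b l L → dirD u (cubeWeight w) N φ l L = 0) :
    ∃ t : M, ∀ x, a ≤ x → x ≤ b → φ x I = u ^ (cubeWeight w x I - B₀).toNat • t := by
  have hW := faceMonotone_cubeWeight w
  have hIN : I \ N = I := Finset.sdiff_eq_self_of_disjoint hI
  have inbox : ∀ {a b x : V → ℤ}, a ≤ x → x ≤ b → InBox N I a b x I := by
    intro a b x h1 h2
    refine ⟨hIN, h1, fun y => ?_⟩
    rw [if_neg fun h => Finset.disjoint_left.1 hI h.1 h.2, add_zero]
    exact h2 y
  induction hC with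
  | point a =>
    -- Divisibility enters only at the final point of the collapse; the same `t` then serves every
    -- added layer.
    obtain ⟨t, ht⟩ := exists_pow_smul_eq u hu (cubeWeight w a I - B₀).toNat (φ a I)
    exact ⟨t, fun x h1 h2 => by rw [le_antisymm h2 h1, ht]⟩
  | @top a b v hv h ih hrec =>
    have hvN : v ∈ N := by by_contra hvN; exact hv.ne (hab v hvN)
    have hvI : v ∉ I := fun h => Finset.disjoint_left.1 hI h hvN
    have hE := isExpansion_top w hvN hv h
    obtain ⟨t, ht⟩ := hrec (fun x hx => by
      have : x ≠ v := by rintro rfl; exact hx hvN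
      simp [this, hab x hx]) (fun l L ⟨h1, h2, h3⟩ =>
        hφ l L ⟨h1, h2, fun x => (h3 x).trans (by
        simp only [Pi.sub_apply, Pi.single_apply]; split_ifs <;> omega)⟩)
    refine ⟨t, fun x h1 h2 => ?_⟩
    by_cases hx : x ≤ b - Pi.single v 1
    · exact ht x h1 hx
    have hnA : ¬InBox N I a (b - Pi.single v 1) x I := fun hh => hx fun y => by
      have := hh.2.2 y
      rwa [if_neg fun h => Finset.disjoint_left.1 hI h.1 h.2, add_zero] at this
    obtain ⟨l', rfl, hB', hnA'⟩ := hE.thick x I (inbox h1 h2) hnA hvI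
    obtain ⟨-, hA'', hw⟩ := hE.near _ _ hB' hnA' (Finset.mem_insert_self _ _)
    have hd := (dirD_edge_eq_zero u hvN hI φ l').1 (hφ _ _ hB')
    simp only [Finset.erase_insert hvI, shift_true, Bool.not_true, shift_false] at hw hA'' ⊢
    have hA3 := hA''.mem_Icc_of_subset (Finset.empty_subset _)
    rw [vertexVec_empty, add_zero] at hA3
    -- The edge weighs as much as its new end, so the cocycle condition expresses the new value
    -- through the old one without any division.
    rw [hw, sub_self, Int.toNat_zero, pow_zero, one_smul, ht l' hA3.1 hA3.2,
      smul_pow_toNat_comp u _ (hB _)] at hd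
    · exact hd
    · rw [← hw]
      have := hW l' (insert v I) v (Finset.mem_insert_self _ _) false
      rwa [shift_false, Finset.erase_insert hvI] at this
  | @bot a b v hv h ih hrec =>
    have hvN : v ∈ N := by by_contra hvN; exact hv.ne (hab v hvN)
    have hvI : v ∉ I := fun h => Finset.disjoint_left.1 hI h hvN
    have hE := isExpansion_bot w hvN hv h
    obtain ⟨t, ht⟩ := hrec (fun x hx => by
      have : x ≠ v := by rintro rfl; exact hx hvN
      simp [this, hab x hx]) (fun l L ⟨h1, h2, h3⟩ =>
        hφ l L ⟨h1, fun x => le_trans (by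
        simp only [Pi.add_apply, Pi.single_apply]; split_ifs <;> omega) (h2 x), h3⟩)
    refine ⟨t, fun x h1 h2 => ?_⟩
    by_cases hx : a + Pi.single v 1 ≤ x
    · exact ht x hx h2
    have hnA : ¬InBox N I (a + Pi.single v 1) b x I := fun hh => hx hh.2.1
    obtain ⟨l', rfl, hB', hnA'⟩ := hE.thick x I (inbox h1 h2) hnA hvI
    obtain ⟨-, hA'', hw⟩ := hE.near _ _ hB' hnA' (Finset.mem_insert_self _ _)
    have hd := (dirD_edge_eq_zero u hvN hI φ l').1 (hφ _ _ hB')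
    simp only [Finset.erase_insert hvI, shift_true, Bool.not_false, shift_false] at hw hA'' ⊢
    have hA3 := hA''.mem_Icc_of_subset (Finset.empty_subset _)
    rw [vertexVec_empty, add_zero] at hA3
    rw [hw, sub_self, Int.toNat_zero, pow_zero, one_smul, ht _ hA3.1 hA3.2,
      smul_pow_toNat_comp u _ (hB _)] at hd
    · exact hd.symm
    · rw [← hw]
      have := hW l' (insert v I) v (Finset.mem_insert_self _ _) true
      rwa [shift_true, Finset.erase_insert hvI] at this

end Box

/-- Sum `g` from 0 in both directions. This is the vanishing of the first cohomology of the line,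
responsible for the first bad vertex costing no degree. -/
theorem exists_forwardDifference_eq {M : Type*} [AddCommGroup M] (g : ℤ → M) :
    ∃ s : ℤ → M, ∀ n, s (n + 1) - s n = g n := by
  refine ⟨fun n => ∑ k ∈ Finset.range n.toNat, g k -
    ∑ k ∈ Finset.range (-n).toNat, g (-(k : ℤ) - 1), fun n => ?_⟩
  rcases le_or_gt 0 n with h | h
  · have h1 : (n + 1).toNat = n.toNat + 1 := by omega
    have h2 : (-(n + 1)).toNat = 0 := by omega
    have h3 : (-n).toNat = 0 := by omega
    have h4 : (n.toNat : ℤ) = n := by omega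
    simp only [h1, h2, h3, Finset.sum_range_succ, h4, Finset.sum_range_zero]
    abel
  · have h1 : (-n).toNat = (-(n + 1)).toNat + 1 := by omega
    have h2 : (n + 1).toNat = 0 := by omega
    have h3 : n.toNat = 0 := by omega
    have h4 : (((-(n + 1)).toNat : ℕ) : ℤ) = -(n + 1) := by omega
    have h5 : -(-(n + 1)) - 1 = n := by ring
    simp only [h1, Finset.sum_range_succ, h2, h3, h4, h5, Finset.sum_range_zero]
    abel

/-! ### Passage from boxes to infinite fibers -/

section Fiber

variable {V : Type*} [LinearOrder V] {N I : Finset V}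
variable {M : Type*} [AddCommGroup M] {R : Type*} [CommRing R] [Module R M] (u : R)
  (w : (V → ℤ) → ℤ)

/-- The cochain supported on the cubes without directions in `N` which is given by the powers of `u`
determined by the weights, up to the coefficients `τ`. -/
def standardCochain (N : Finset V) (B₀ : ℤ) (τ : (V → ℤ) → Finset V → M) :
    (V → ℤ) → Finset V → M := fun l L =>
  if L ∩ N = ∅ then u ^ (cubeWeight w l L - B₀).toNat • τ l L else 0

/-- On a cube with exactly one direction in `N`, both ends contribute the same power of `u` applied
to the same coefficient, with opposite signs. -/
theorem dirD_standardCochain {B₀ : ℤ} (hB : ∀ l, B₀ ≤ w l) {τ : (V → ℤ) → Finset V → M}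
    (hτ : ∀ l L, ∀ j ∈ N, ∀ b, τ (shift l j b) L = τ l L) :
    dirD u (cubeWeight w) N (standardCochain u w N B₀ τ) = 0 := by
  funext l L
  refine Finset.sum_eq_zero fun j hj => ?_
  by_cases hjL : j ∈ L
  swap
  · exact partialD_of_notMem u _ _ _ hjL
  by_cases hL : L.erase j ∩ N = ∅
  · have hW := faceMonotone_cubeWeight w l L j hjL
    have hB' : ∀ l L, B₀ ≤ cubeWeight w l L := fun l L =>
      (hB _).trans (le_cubeWeight w l (Finset.empty_subset L))
    simp only [partialD, if_pos hjL, standardCochain, if_pos hL, hτ _ _ j hj,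
      smul_pow_toNat_comp u (hW _) (hB' _ _)]
    simp [endSign]
  · exact partialD_eq_zero u _ fun _ b => if_neg hL

theorem cubeWeight_bddBelow {B₀ : ℤ} (hB : ∀ l, B₀ ≤ w l) (l : V → ℤ) (L : Finset V) :
    B₀ ≤ cubeWeight w l L :=
  (hB _).trans (le_cubeWeight w l (Finset.empty_subset L))

/-- A primitive on a collapsible box extends to a primitive on a larger collapsible box. -/
theorem exists_primitive_extending {a b a' b' : V → ℤ} {B₀ : ℤ} (hB : ∀ l, B₀ ≤ w l)
    (hu : ∀ m : M, ∃ m', u • m' = m) (hI : Disjoint I N)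
    (hC : Collapsible (fun x => cubeWeight w x I) a b)
    (hC' : Collapsible (fun x => cubeWeight w x I) a' b')
    (hab : ∀ x, x ∉ N → a x = b x) (hab' : ∀ x, x ∉ N → a' x = b' x)
    (hsub : ∀ l L, InBox N I a b l L → InBox N I a' b' l L)
    {φ : (V → ℤ) → Finset V → M} (hφ : dirD u (cubeWeight w) N φ = 0)
    (h0 : ∀ l L, L ∩ N = ∅ → φ l L = 0) {ψ : (V → ℤ) → Finset V → M}
    (hψ : ∀ l L, InBox N I a b l L → dirD u (cubeWeight w) N ψ l L = φ l L) :
    ∃ ψ' : (V → ℤ) → Finset V → M,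
      (∀ l L, InBox N I a' b' l L → dirD u (cubeWeight w) N ψ' l L = φ l L) ∧
      ∀ l L, InBox N I a b l L → ψ' l L = ψ l L := by
  have hW := faceMonotone_cubeWeight w
  obtain ⟨ψ₁, h₁⟩ := hC'.exists_primitive u w hab' (fun l L _ => by rw [hφ]; rfl) h0
  have hρ : ∀ l L, InBox N I a b l L → dirD u (cubeWeight w) N (ψ - ψ₁) l L = 0 := by
    intro l L h
    rw [dirD_sub, Pi.sub_apply, Pi.sub_apply, hψ l L h, h₁ l L (hsub l L h), sub_self]
  -- The part of positive degree of the closed difference `ψ - ψ₁`. It is closed as well: the faces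
  -- of a cube in directions of `N` are either all of degree zero or all of positive degree.
  let ρ : (V → ℤ) → Finset V → M := fun l L => if L ∩ N = ∅ then 0 else (ψ - ψ₁) l L
  have hρp : ∀ l L, InBox N I a b l L → dirD u (cubeWeight w) N ρ l L = 0 := by
    intro l L h
    by_cases hex : ∃ j ∈ N, j ∈ L ∧ L.erase j ∩ N = ∅
    · obtain ⟨j, hj, hjL, he⟩ := hex
      refine dirD_eq_zero u _ fun i hi hiL b => if_pos ?_
      have : i = j := by
        by_contra hij
        have : i ∈ L.erase j ∩ N := by simp [hij, hiL, hi]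
        simp [he] at this
      rw [this, he]
    · push Not at hex
      rw [← hρ l L h]
      exact dirD_congr u _ fun j hj hjL b => if_neg (hex j hj hjL).ne_empty
  obtain ⟨η, hη⟩ := hC.exists_primitive u w hab hρp fun l L hL => if_pos hL
  obtain ⟨t, ht⟩ := hC.exists_eq_smul u w (φ := ψ - ψ₁ - ρ) hab hI hu
    (fun l => cubeWeight_bddBelow w hB l I) (fun l L h => by
      rw [dirD_sub, Pi.sub_apply, Pi.sub_apply, hρ l L h, hρp l L h, sub_self])
  -- On the small box `ψ - ψ₁` equals `dη` in positive degree and a standard cochain in degree zero.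
  -- Both are defined and closed everywhere, so adding them to `ψ₁` keeps it a primitive on the
  -- large box.
  refine ⟨ψ₁ + dirD u (cubeWeight w) N η + standardCochain u w N B₀ fun _ _ => t,
    fun l L h => ?_, fun l L h => ?_⟩
  · rw [dirD_add, dirD_add, dirD_dirD u hW, dirD_standardCochain u w hB fun _ _ _ _ _ => rfl,
      add_zero, add_zero, h₁ l L h]
  · simp only [Pi.add_apply, hη l L h, standardCochain]
    by_cases hL : L ∩ N = ∅
    · have hLI : L = I := by
        rw [← h.1, eq_comm, Finset.sdiff_eq_self_iff_disjoint, Finset.disjoint_iff_inter_eq_empty,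
          hL]
      have hm := h.mem_Icc_of_subset (Finset.empty_subset _)
      rw [vertexVec_empty, add_zero] at hm
      have := ht l hm.1 hm.2
      rw [← hLI] at this
      rw [if_pos hL, ← this]
      simp [ρ, hL]
    · simp [ρ, hL]

/-- The centered box of radius `m` in the directions `N` of the fiber through `i`. -/
def fiberBound (N : Finset V) (i : V → ℤ) (m : ℤ) : V → ℤ := fun x => if x ∈ N then m else i x

theorem exists_inBox [Fintype V] {i l : V → ℤ} {L : Finset V} (hL : L \ N = I)
    (hl : ∀ x, x ∉ N → l x = i x) : ∃ m₀ : ℕ, ∀ m : ℕ, m₀ ≤ m →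
      InBox N I (fiberBound N i (-m)) (fiberBound N i m) l L := by
  -- The extra 1 leaves room for the upper vertices of the cube.
  refine ⟨∑ x, (l x).natAbs + 1, fun m hm => ⟨hL, fun x => ?_, fun x => ?_⟩⟩ <;>
  · have := Finset.single_le_sum (f := fun x => (l x).natAbs) (fun _ _ => Nat.zero_le _)
      (Finset.mem_univ x)
    simp only [fiberBound]
    by_cases hx : x ∈ N
    · simp only [hx, if_true, and_true]
      try split_ifs <;> omega
      try omega
    · simp [hx, hl x hx]

variable {w}

/-- Every finite box in the directions `N` is collapsible for the weights of all families of parallel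
cubes transversal to `N`. -/
def FibersCollapsible (N : Finset V) (w : (V → ℤ) → ℤ) : Prop :=
  ∀ I, Disjoint I N → ∀ a b : V → ℤ, a ≤ b → (∀ x, x ∉ N → a x = b x) →
    Collapsible (fun x => cubeWeight w x I) a b

theorem FibersCollapsible.fiber (h : FibersCollapsible N w) (hI : Disjoint I N) (i : V → ℤ)
    (m : ℕ) : Collapsible (fun x => cubeWeight w x I) (fiberBound N i (-m)) (fiberBound N i m) :=
  h I hI _ _ (fun x => by simp only [fiberBound]; split_ifs <;> omega)
    fun x hx => by simp [fiberBound, hx]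

theorem fiberBound_eq {i : V → ℤ} {m m' : ℤ} (x : V) (hx : x ∉ N) :
    fiberBound N i m x = fiberBound N i m' x := by simp [fiberBound, hx]

theorem InBox.mono_fiber {i : V → ℤ} {m m' : ℕ} (hm : m ≤ m') {l : V → ℤ} {L : Finset V}
    (h : InBox N I (fiberBound N i (-m)) (fiberBound N i m) l L) :
    InBox N I (fiberBound N i (-m')) (fiberBound N i m') l L := by
  obtain ⟨h1, h2, h3⟩ := h
  refine ⟨h1, fun x => (h2 x).trans' ?_, fun x => (h3 x).trans ?_⟩ <;>
  · simp only [fiberBound]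
    split_ifs <;> omega

theorem FibersCollapsible.exists_primitive_fiber [Fintype V] (h : FibersCollapsible N w)
    {B₀ : ℤ} (hB : ∀ l, B₀ ≤ w l) (hu : ∀ m : M, ∃ m', u • m' = m) (hI : Disjoint I N)
    {φ : (V → ℤ) → Finset V → M} (hφ : dirD u (cubeWeight w) N φ = 0)
    (h0 : ∀ l L, L ∩ N = ∅ → φ l L = 0) (i : V → ℤ) :
    ∃ ψ : (V → ℤ) → Finset V → M, ∀ l L, L \ N = I → (∀ x, x ∉ N → l x = i x) →
      dirD u (cubeWeight w) N ψ l L = φ l L := by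
  -- Primitives on the centered boxes of growing radius are chosen so that each extends the previous
  -- one.
  let P : ℕ → ((V → ℤ) → Finset V → M) → Prop := fun m ψ => ∀ l L,
    InBox N I (fiberBound N i (-m)) (fiberBound N i m) l L →
      dirD u (cubeWeight w) N ψ l L = φ l L
  have start : ∃ ψ, P 0 ψ := (h.fiber hI i 0).exists_primitive u w fiberBound_eq
    (fun l L _ => by rw [hφ]; rfl) h0
  have step : ∀ m, ∀ ψ : {ψ // P m ψ}, ∃ ψ' : {ψ' // P (m + 1) ψ'}, ∀ l L,
      InBox N I (fiberBound N i (-m)) (fiberBound N i m) l L → ψ'.1 l L = ψ.1 l L := by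
    rintro m ⟨ψ, hψ⟩
    obtain ⟨ψ', h1, h2⟩ := exists_primitive_extending u w hB hu hI (h.fiber hI i m)
      (h.fiber hI i (m + 1)) fiberBound_eq fiberBound_eq
      (fun l L hl => hl.mono_fiber m.le_succ) hφ h0 hψ
    exact ⟨⟨ψ', h1⟩, h2⟩
  choose next hnext using step
  let s : ∀ m, {ψ // P m ψ} := fun m => Nat.rec ⟨start.choose, start.choose_spec⟩ next m
  have hs : ∀ (m : ℕ) l L, InBox N I (fiberBound N i (-m)) (fiberBound N i m) l L →
      ∀ m' : ℕ, m ≤ m' → (s m').1 l L = (s m).1 l L := by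
    intro m l L hl m' hm
    induction m', hm using Nat.le_induction with
    | base => rfl
    | succ k hk ih => exact (hnext k (s k) l L (hl.mono_fiber hk)).trans ih
  have hex : ∀ l L, ∃ m₀ : ℕ, L \ N = I → (∀ x, x ∉ N → l x = i x) →
      InBox N I (fiberBound N i (-m₀)) (fiberBound N i m₀) l L := by
    intro l L
    by_cases hL : L \ N = I ∧ ∀ x, x ∉ N → l x = i x
    · obtain ⟨m₀, hm₀⟩ := exists_inBox hL.1 hL.2
      exact ⟨m₀, fun _ _ => hm₀ m₀ le_rfl⟩
    · exact ⟨0, fun h1 h2 => absurd ⟨h1, h2⟩ hL⟩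
  choose n hn using hex
  refine ⟨fun l L => (s (n l L)).1 l L, fun l L hL hl => ?_⟩
  have hbox := hn l L hL hl
  -- Each face takes its value from its own stage, but that agrees with the stage of the cube
  -- because the face lies in the boxes of both.
  rw [← (s (n l L)).2 l L hbox]
  refine dirD_congr u _ fun j hj hjL b => ?_
  have hface := hbox.face hj hjL b
  have hface' := hn (shift l j b) (L.erase j) hface.1 (fun x hx => by
    have : x ≠ j := by rintro rfl; exact hx hj
    simp [shift_apply, this, hl x hx])
  rcases le_total (n l L) (n (shift l j b) (L.erase j)) with hle | hle
  · exact hs _ _ _ hface _ hle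
  · exact (hs _ _ _ hface' _ hle).symm

/-- The projection to the directions outside `N`. -/
def transversalPart (N : Finset V) (l : V → ℤ) : V → ℤ := fun x => if x ∈ N then 0 else l x

theorem transversalPart_shift (l : V → ℤ) {j : V} (hj : j ∈ N) (b : Bool) :
    transversalPart N (shift l j b) = transversalPart N l := by
  funext x
  simp only [transversalPart, shift_apply]
  split_ifs with h1 h2
  · rfl
  · exact absurd (h2.2 ▸ hj) h1
  · simp

/-- Cocycles of positive degree in the directions `N` have primitives. -/
theorem FibersCollapsible.exists_primitive [Fintype V] (h : FibersCollapsible N w)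
    {B₀ : ℤ} (hB : ∀ l, B₀ ≤ w l) (hu : ∀ m : M, ∃ m', u • m' = m)
    {φ : (V → ℤ) → Finset V → M} (hφ : dirD u (cubeWeight w) N φ = 0)
    (h0 : ∀ l L, L ∩ N = ∅ → φ l L = 0) :
    ∃ ψ : (V → ℤ) → Finset V → M, dirD u (cubeWeight w) N ψ = φ := by
  have hex : ∀ (i : V → ℤ) (I : Finset V), ∃ ψ : (V → ℤ) → Finset V → M, Disjoint I N →
      ∀ l L, L \ N = I → (∀ x, x ∉ N → l x = i x) →
      dirD u (cubeWeight w) N ψ l L = φ l L := by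
    intro i I
    by_cases hI : Disjoint I N
    · obtain ⟨ψ, hψ⟩ := h.exists_primitive_fiber u hB hu hI hφ h0 i
      exact ⟨ψ, fun _ => hψ⟩
    · exact ⟨0, fun hh => absurd hh hI⟩
  choose ψ hψ using hex
  -- The partial coboundaries in `N` preserve the transversal part, so primitives chosen
  -- independently on the fibers fit together.
  refine ⟨fun l L => ψ (transversalPart N l) (L \ N) l L, ?_⟩
  funext l L
  rw [← hψ (transversalPart N l) (L \ N) Finset.sdiff_disjoint l L rfl
    (fun x hx => by simp [transversalPart, hx])]
  refine dirD_congr u _ fun j hj hjL b => ?_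
  rw [transversalPart_shift l hj, Finset.erase_sdiff_comm,
    Finset.erase_eq_of_notMem (by simp [hj])]

/-- Cocycles of degree zero in the directions `N` are standard on every fiber. -/
theorem FibersCollapsible.exists_eq_smul [Fintype V] (h : FibersCollapsible N w)
    {B₀ : ℤ} (hB : ∀ l, B₀ ≤ w l) (hu : ∀ m : M, ∃ m', u • m' = m) (hI : Disjoint I N)
    {φ : (V → ℤ) → Finset V → M} (hφ : dirD u (cubeWeight w) N φ = 0) (i : V → ℤ) :
    ∃ t : M, ∀ l, (∀ x, x ∉ N → l x = i x) →
      φ l I = u ^ (cubeWeight w l I - B₀).toNat • t := by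
  have hIN : I \ N = I := Finset.sdiff_eq_self_of_disjoint hI
  -- The coefficient of a box need not be unique, since `u` may have torsion. At a point `p` of
  -- least weight in the fiber, `φ p I` determines all other values, so a `t` fitting `p` fits
  -- everywhere.
  obtain ⟨z, ⟨p, hp, rfl⟩, hz⟩ := Int.exists_least_of_bdd
    (P := fun z => ∃ l, (∀ x, x ∉ N → l x = i x) ∧ cubeWeight w l I = z)
    ⟨B₀, by rintro z ⟨l, -, rfl⟩; exact cubeWeight_bddBelow w hB l I⟩ ⟨_, i, fun _ _ => rfl, rfl⟩
  obtain ⟨t, ht⟩ := exists_pow_smul_eq u hu (cubeWeight w p I - B₀).toNat (φ p I)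
  refine ⟨t, fun l hl => ?_⟩
  obtain ⟨m₁, h₁⟩ := exists_inBox hIN hp
  obtain ⟨m₂, h₂⟩ := exists_inBox hIN hl
  obtain ⟨t', ht'⟩ := (h.fiber hI i (max m₁ m₂)).exists_eq_smul u w (φ := φ) fiberBound_eq hI hu
    (fun l => cubeWeight_bddBelow w hB l I) (fun l L _ => by rw [hφ]; rfl)
  have e₁ := (h₁ _ (le_max_left m₁ m₂)).mem_Icc_of_subset (Finset.empty_subset _)
  have e₂ := (h₂ _ (le_max_right m₁ m₂)).mem_Icc_of_subset (Finset.empty_subset _)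
  rw [vertexVec_empty, add_zero] at e₁ e₂
  have hlp := hz _ ⟨l, hl, rfl⟩
  rw [ht' l e₂.1 e₂.2, ← smul_pow_toNat_comp u hlp (cubeWeight_bddBelow w hB p I) t',
    ← ht' p e₁.1 e₁.2, ← ht, smul_pow_toNat_comp u hlp (cubeWeight_bddBelow w hB p I) t]

/-- Restriction of degree zero cocycles to the thickening in a direction `j` is surjective, up to
cocycles on all the translates. -/
theorem FibersCollapsible.exists_partialD_eq [Fintype V] (h : FibersCollapsible N w)
    {B₀ : ℤ} (hB : ∀ l, B₀ ≤ w l) (hu : ∀ m : M, ∃ m', u • m' = m) {j : V} (hj : j ∉ N)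
    {φ : (V → ℤ) → Finset V → M} (hφ : dirD u (cubeWeight w) N φ = 0)
    (h0 : ∀ l L, L ∩ N ≠ ∅ → φ l L = 0) (hφj : ∀ l L, j ∉ L → φ l L = 0) :
    ∃ ψ : (V → ℤ) → Finset V → M, dirD u (cubeWeight w) N ψ = 0 ∧
      partialD u (cubeWeight w) j ψ = φ := by
  have hex : ∀ (i : V → ℤ) (I : Finset V), ∃ t : M, I ∩ N = ∅ → ∀ l, (∀ x, x ∉ N → l x = i x) →
      φ l I = u ^ (cubeWeight w l I - B₀).toNat • t := by
    intro i I
    by_cases hI : I ∩ N = ∅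
    · obtain ⟨t, ht⟩ := h.exists_eq_smul u hB hu (Finset.disjoint_iff_inter_eq_empty.2 hI) hφ i
      exact ⟨t, fun _ => ht⟩
    · exact ⟨0, fun hh => absurd hh hI⟩
  choose τ hτ using hex
  -- On standard cochains `partialD` in direction `j` is the forward difference of the coefficients,
  -- up to sign; it is solved along each line parallel to `E_j`.
  have hsum : ∀ K : Finset V, ∃ s : (V → ℤ) → M, ∀ l,
      s (l + Pi.single j 1) - s l = dirSign (insert j K) j • τ l (insert j K) := by
    intro K
    have := fun l : V → ℤ => exists_forwardDifference_eq fun n =>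
      dirSign (insert j K) j • τ (Function.update l j n) (insert j K)
    choose s hs using this
    refine ⟨fun l => s (Function.update l j 0) (l j), fun l => ?_⟩
    have e : Function.update (l + Pi.single j 1) j 0 = Function.update l j 0 := by
      funext x
      by_cases hx : x = j
      · subst hx; simp
      · simp [hx]
    have := hs (Function.update l j 0) (l j)
    simp only [Function.update_idem, Function.update_eq_self] at this
    simpa [e] using this
  choose s hs using hsum
  let σ : (V → ℤ) → Finset V → M := fun l K => s K (transversalPart N l)
  have hstd := dirD_standardCochain (N := N) u w hB (τ := σ) fun l L i hi b => by
    simp only [σ, transversalPart_shift l hi]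
  refine ⟨fun l L => if j ∈ L then 0 else standardCochain u w N B₀ σ l L, ?_, ?_⟩
  · funext l L
    by_cases hjL : j ∈ L
    · refine dirD_eq_zero u _ fun i hi hiL b => if_pos ?_
      exact Finset.mem_erase.2 ⟨by rintro rfl; exact hj hi, hjL⟩
    · rw [← hstd]
      exact dirD_congr u _ fun i hi hiL b => if_neg fun hh => hjL (Finset.mem_of_mem_erase hh)
  · funext l L
    by_cases hjL : j ∈ L
    swap
    · rw [hφj l L hjL, partialD_of_notMem u _ _ _ hjL]
    have hN : L.erase j ∩ N = L ∩ N := by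
      rw [Finset.erase_inter, Finset.erase_eq_of_notMem (by simp [hj])]
    by_cases hL : L ∩ N = ∅
    swap
    · rw [h0 l L hL]
      refine partialD_eq_zero u _ fun _ b => ?_
      rw [if_neg (Finset.notMem_erase j L), standardCochain, if_neg (hN ▸ hL)]
    have hW := faceMonotone_cubeWeight w l L j hjL
    have hT : transversalPart N (l + Pi.single j 1) = transversalPart N l + Pi.single j 1 := by
      funext x
      simp only [transversalPart, Pi.add_apply]
      by_cases hx : x = j
      · subst hx; simp [hj]
      · simp [hx]
    have key := hs (L.erase j) (transversalPart N l)
    rw [Finset.insert_erase hjL] at key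
    rw [hτ (transversalPart N l) L hL l (fun x hx => by simp [transversalPart, hx])]
    simp only [partialD, if_pos hjL, if_neg (Finset.notMem_erase j L), standardCochain,
      if_pos (hN.trans hL), smul_pow_toNat_comp u (hW _) (cubeWeight_bddBelow w hB _ _),
      Fintype.sum_bool, endSign, if_true, shift_true, shift_false, σ, hT, mul_one,
      Bool.false_eq_true, if_false, mul_neg, neg_smul]
    rw [← sub_eq_add_neg, ← smul_sub, ← smul_sub, key, smul_comm, smul_smul, dirSign_mul_self,
      one_smul]

end Fiber

/-! ### Adding the bad directions one at a time -/

section Directions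

variable {V : Type*} [LinearOrder V]
variable {M : Type*} [AddCommGroup M] {R : Type*} [CommRing R] [Module R M] (u : R)

/-- Cocycles of degree `q` in the directions `D` have primitives. -/
def ExactInDegree (M : Type*) [AddCommGroup M] [Module R M] (W : (V → ℤ) → Finset V → ℤ)
    (D : Finset V) (q : ℕ) : Prop :=
  ∀ φ : (V → ℤ) → Finset V → M, (∀ l K, (K ∩ D).card ≠ q → φ l K = 0) → dirD u W D φ = 0 →
    ∃ ψ : (V → ℤ) → Finset V → M, dirD u W D ψ = φ

theorem card_erase_inter_add_one {K D : Finset V} {i : V} (hi : i ∈ D) (hiK : i ∈ K) :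
    (K.erase i ∩ D).card + 1 = (K ∩ D).card := by
  rw [Finset.erase_inter, Finset.card_erase_add_one (Finset.mem_inter.2 ⟨hiK, hi⟩)]

/-- Exactness after adding one more direction. -/
theorem ExactInDegree.insert_of {W : (V → ℤ) → Finset V → ℤ} (hW : FaceMonotone W)
    {D : Finset V} {j : V} (hj : j ∉ D) {q : ℕ} (h₁ : ExactInDegree u M W D q)
    (h₂ : ∀ φ : (V → ℤ) → Finset V → M, (∀ l K, j ∉ K → φ l K = 0) →
      (∀ l K, (K ∩ D).card + 1 ≠ q → φ l K = 0) → dirD u W D φ = 0 →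
      ∃ ψ : (V → ℤ) → Finset V → M, dirD u W (insert j D) ψ = φ) :
    ExactInDegree u M W (insert j D) q := by
  intro φ hφq hφ
  have card_in : ∀ K : Finset V, j ∈ K → (K ∩ insert j D).card = (K ∩ D).card + 1 := by
    intro K hK
    rw [Finset.inter_insert_of_mem hK, Finset.card_insert_of_notMem (by simp [hj])]
  have card_out : ∀ K : Finset V, j ∉ K → K ∩ insert j D = K ∩ D := by
    intro K hK
    rw [Finset.inter_insert_of_notMem hK]
  have mem_erase : ∀ {i : V} {K : Finset V}, i ∈ D → j ∈ K → j ∈ K.erase i := by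
    intro i K hi hK
    exact Finset.mem_erase.2 ⟨by rintro rfl; exact hj hi, hK⟩
  -- First solve on the cubes without direction `j`, where the coboundary for `insert j D` is the
  -- one for `D`.
  obtain ⟨ψ, hψ⟩ := h₁ (fun l K => if j ∈ K then 0 else φ l K) (fun l K hK => by
      split_ifs with hjK
      · rfl
      · exact hφq l K (by rwa [card_out K hjK])) (by
      funext l K
      by_cases hjK : j ∈ K
      · exact dirD_eq_zero u W fun i hi _ b => if_pos (mem_erase hi hjK)
      · have := congrFun (congrFun hφ l) K
        rw [dirD_insert u W hj, Pi.add_apply, Pi.add_apply, partialD_of_notMem u W _ _ hjK,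
          zero_add] at this
        rw [← this]
        exact dirD_congr u W fun i _ _ b => if_neg fun h => hjK (Finset.mem_of_mem_erase h))
  -- Truncation to degree `q - 1` on cubes without `j` keeps the correction `φ - dψ₀` homogeneous.
  let ψ₀ : (V → ℤ) → Finset V → M := fun l K =>
    if j ∉ K ∧ (K ∩ D).card + 1 = q then ψ l K else 0
  have hψ₀ : ∀ l K, dirD u W D ψ₀ l K = if j ∈ K then 0 else φ l K := by
    intro l K
    by_cases hjK : j ∈ K
    · rw [if_pos hjK]
      exact dirD_eq_zero u W fun i hi _ b => if_neg fun h => h.1 (mem_erase hi hjK)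
    by_cases hK : (K ∩ D).card = q
    · rw [← congrFun (congrFun hψ l) K]
      exact dirD_congr u W fun i hi hiK b => if_pos
        ⟨fun h => hjK (Finset.mem_of_mem_erase h), by rw [card_erase_inter_add_one hi hiK, hK]⟩
    · rw [if_neg hjK, hφq l K (by rwa [card_out K hjK])]
      exact dirD_eq_zero u W fun i hi hiK b => if_neg fun h => hK (by
        rw [← card_erase_inter_add_one hi hiK, h.2])
  have hχ : ∀ l K, j ∉ K → (φ - dirD u W (insert j D) ψ₀) l K = 0 := by
    intro l K hjK
    rw [dirD_insert u W hj]
    simp [hψ₀, hjK, partialD_of_notMem u W _ _ hjK]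
  have hcoc : dirD u W (insert j D) (φ - dirD u W (insert j D) ψ₀) = 0 := by
    rw [dirD_sub, hφ, dirD_dirD u hW, sub_zero]
  -- The remainder lives on the cubes with direction `j`, is closed for `D`, and has degree `q - 1`
  -- in the directions `D`.
  obtain ⟨ψ₁, hψ₁⟩ := h₂ (φ - dirD u W (insert j D) ψ₀) hχ (by
      intro l K hK
      by_cases hjK : j ∈ K
      swap
      · exact hχ l K hjK
      have h0 : partialD u W j ψ₀ l K = 0 := partialD_eq_zero u W fun _ b => if_neg fun h => hK (by
        rw [← h.2, Finset.erase_inter, Finset.erase_eq_of_notMem (by simp [hj])])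
      rw [dirD_insert u W hj]
      simp [hψ₀, hjK, h0, hφq l K (by rwa [card_in K hjK])]) (by
      funext l K
      by_cases hjK : j ∈ K
      · have h0 := congrFun (congrFun hcoc l) K
        rw [dirD_insert u W hj (φ - _)] at h0
        rw [Pi.add_apply, Pi.add_apply, partialD_eq_zero u W fun _ b =>
          hχ _ _ (Finset.notMem_erase j K), zero_add] at h0
        exact h0
      · exact dirD_eq_zero u W fun i _ _ b => hχ _ _ fun h => hjK (Finset.mem_of_mem_erase h))
  exact ⟨ψ₀ + ψ₁, by rw [dirD_add, hψ₁, add_sub_cancel]⟩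

/-- A primitive in the directions `D` yields one in the directions `insert j D` for cochains
supported on the cubes with direction `j`. -/
theorem ExactInDegree.exists_insert {W : (V → ℤ) → Finset V → ℤ}
    {D : Finset V} {j : V} (hj : j ∉ D) {q : ℕ} (h : ExactInDegree u M W D q)
    {φ : (V → ℤ) → Finset V → M} (hφj : ∀ l K, j ∉ K → φ l K = 0)
    (hφq : ∀ l K, (K ∩ D).card ≠ q → φ l K = 0) (hφ : dirD u W D φ = 0) :
    ∃ ψ : (V → ℤ) → Finset V → M, dirD u W (insert j D) ψ = φ := by
  obtain ⟨ψ, hψ⟩ := h φ hφq hφ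
  refine ⟨fun l K => if j ∈ K then ψ l K else 0, ?_⟩
  funext l K
  rw [dirD_insert u W hj, Pi.add_apply, Pi.add_apply,
    partialD_eq_zero u W fun _ b => if_neg (Finset.notMem_erase j K), zero_add]
  by_cases hjK : j ∈ K
  · rw [← hψ]
    exact dirD_congr u W fun i hi _ b => if_pos
      (Finset.mem_erase.2 ⟨by rintro rfl; exact hj hi, hjK⟩)
  · rw [hφj l K hjK]
    exact dirD_eq_zero u W fun i _ _ b => if_neg fun h => hjK (Finset.mem_of_mem_erase h)

variable {w : (V → ℤ) → ℤ} {N : Finset V}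

/-- If all finite boxes in the directions `N` are collapsible, then the cohomology in the directions
`N ∪ J` vanishes in degrees at least `|J|`, for non-empty `J`. -/
theorem FibersCollapsible.exactInDegree [Fintype V] (h : FibersCollapsible N w)
    {B₀ : ℤ} (hB : ∀ l, B₀ ≤ w l) (hu : ∀ m : M, ∃ m', u • m' = m) (J : Finset V)
    (hJ : J.Nonempty) (hJN : Disjoint J N) {q : ℕ} (hq : J.card ≤ q) :
    ExactInDegree u M (cubeWeight w) (J ∪ N) q := by
  have hW := faceMonotone_cubeWeight w
  have hN : ∀ q, 1 ≤ q → ExactInDegree u M (cubeWeight w) N q := by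
    intro q hq φ hφq hφ
    refine h.exists_primitive u hB hu hφ fun l L hL => hφq l L ?_
    rw [hL, Finset.card_empty]; omega
  induction J using Finset.induction_on generalizing q with
  | empty => exact absurd hJ Finset.not_nonempty_empty
  | insert j s hjs ih =>
    rw [Finset.card_insert_of_notMem hjs] at hq
    obtain ⟨hjN, hsN⟩ := Finset.disjoint_insert_left.1 hJN
    obtain ⟨p, rfl⟩ : ∃ p, q = p + 1 := ⟨q - 1, by omega⟩
    rw [Finset.insert_union]
    have hj : j ∉ s ∪ N := by simp [hjs, hjN]
    rcases s.eq_empty_or_nonempty with rfl | hs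
    · rw [Finset.empty_union] at hj ⊢
      refine (hN _ (by omega)).insert_of u hW hj fun φ hφj hφq hφ => ?_
      simp only [ne_eq, add_left_inj] at hφq
      -- Degree 1 with a single bad direction leaves a remainder of degree zero in `N`, where
      -- exactness is unavailable and the forward difference replaces it.
      rcases p.eq_zero_or_pos with rfl | hp
      · obtain ⟨ψ, h1, h2⟩ := h.exists_partialD_eq u hB hu hj hφ
          (fun l L hL => hφq l L (by rwa [Finset.card_eq_zero])) hφj
        exact ⟨ψ, by rw [dirD_insert u _ hj, h1, h2, add_zero]⟩
      · exact (hN p hp).exists_insert u hj hφj hφq hφ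
    · refine (ih hs hsN (q := p + 1) (by omega)).insert_of u hW hj fun φ hφj hφq hφ => ?_
      simp only [ne_eq, add_left_inj] at hφq
      exact (ih hs hsN (q := p) (by omega)).exists_insert u hj hφj hφq hφ

end Directions

/-! ### Comparison with the lattice cochain complex -/

section Comparison

variable {V : Type*}

/-- The component of degree `q` of a cochain on all cubes. -/
noncomputable def component (q : ℕ) (φ : (V → ℤ) → Finset V → TPlus) : LatticeCochain V q :=
  Finsupp.linearCombination ℤ fun c : LatticeCube V q => φ c.corner c.dirs

theorem component_single (q : ℕ) (φ : (V → ℤ) → Finset V → TPlus) (c : LatticeCube V q) :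
    component q φ (Finsupp.single c 1) = φ c.corner c.dirs := by
  simp [component]

/-- Extension by zero of a cochain of degree `q` to all cubes. -/
noncomputable def extendCochain {q : ℕ} (φ : LatticeCochain V q) :
    (V → ℤ) → Finset V → TPlus := fun l K =>
  if h : K.card = q then φ (Finsupp.single ⟨l, K, h⟩ 1) else 0

theorem component_extendCochain {q : ℕ} (φ : LatticeCochain V q) :
    component q (extendCochain φ) = φ := by
  ext c
  simp only [LinearMap.coe_comp, Function.comp_apply, Finsupp.lsingle_apply, component_single]
  rw [extendCochain, dif_pos c.card_dirs]

variable [LinearOrder V]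

theorem dirD_univ_apply [Fintype V] (w : (V → ℤ) → ℤ) {q : ℕ}
    (φ : (V → ℤ) → Finset V → TPlus) (c : LatticeCube V (q + 1)) :
    dirD (Polynomial.X : Polynomial ℤ) (cubeWeight w) Finset.univ φ c.corner c.dirs =
      latticeCoboundary w q (component q φ) (Finsupp.single c 1) := by
  rw [latticeCoboundary_single, Fintype.sum_prod_type, dirD]
  rw [← Finset.sum_subset (Finset.subset_univ c.dirs)
    fun j _ hj => partialD_of_notMem _ _ _ _ hj, ← Finset.sum_coe_sort]
  refine Finset.sum_congr rfl fun j _ => ?_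
  rw [partialD, if_pos j.2]
  refine Finset.sum_congr rfl fun b _ => ?_
  rw [component_single]
  rfl

theorem latticeCoboundary_component [Fintype V] (w : (V → ℤ) → ℤ) (q : ℕ)
    (φ : (V → ℤ) → Finset V → TPlus) :
    latticeCoboundary w q (component q φ) = component (q + 1)
      (dirD (Polynomial.X : Polynomial ℤ) (cubeWeight w) Finset.univ φ) := by
  ext c
  simp only [LinearMap.coe_comp, Function.comp_apply, Finsupp.lsingle_apply, component_single,
    dirD_univ_apply]

theorem dirD_extendCochain [Fintype V] (w : (V → ℤ) → ℤ) {q : ℕ} {φ : LatticeCochain V q}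
    (hφ : latticeCoboundary w q φ = 0) :
    dirD (Polynomial.X : Polynomial ℤ) (cubeWeight w) Finset.univ (extendCochain φ) = 0 := by
  funext l K
  by_cases hK : K.card = q + 1
  · have := dirD_univ_apply w (extendCochain φ) ⟨l, K, hK⟩
    rw [component_extendCochain, hφ] at this
    exact this
  · refine dirD_eq_zero _ _ fun j _ hj b => dif_neg fun h => hK ?_
    rw [← h, Finset.card_erase_add_one hj]

theorem subsingleton_latticeCohomology [Fintype V] {w : (V → ℤ) → ℤ} {q : ℕ}
    (h : ExactInDegree (Polynomial.X : Polynomial ℤ) TPlus (cubeWeight w) Finset.univ (q + 1)) :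
    Subsingleton (LatticeCohomology w (q + 1)) := by
  rw [Submodule.Quotient.subsingleton_iff, Submodule.submoduleOf_eq_top]
  intro φ hφ
  obtain ⟨ψ, hψ⟩ := h (extendCochain φ) (fun l K hK => dif_neg (by simpa using hK))
    (dirD_extendCochain w hφ)
  refine ⟨component q ψ, ?_⟩
  rw [latticeCoboundary_component, hψ, component_extendCochain]

/-- The variable is invertible on Laurent polynomials, hence acts surjectively on their quotient. -/
theorem exists_X_smul_eq (m : TPlus) : ∃ m' : TPlus, (Polynomial.X : Polynomial ℤ) • m' = m := by
  obtain ⟨p, rfl⟩ := Submodule.Quotient.mk_surjective _ m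
  refine ⟨Submodule.Quotient.mk (LaurentPolynomial.T (-1) * p), ?_⟩
  rw [← Submodule.Quotient.mk_smul]
  congr 1
  rw [Algebra.smul_def, ← mul_assoc]
  have : (algebraMap (Polynomial ℤ) (LaurentPolynomial ℤ)) Polynomial.X =
    LaurentPolynomial.T 1 := by simp
  rw [this, ← LaurentPolynomial.T_add]
  simp

end Comparison

/-! ### Integral pairing with basis elements -/

section Pairing

variable {V : Type*} [Fintype V]

/-- The pairing `∑ y, c v y * x y` of the basis element `v` with `x`. -/
def pairing (c : V → V → ℤ) (v : V) (x : V → ℤ) : ℤ := ∑ y, c v y * x y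

theorem pairing_add (c : V → V → ℤ) (v : V) (x y : V → ℤ) :
    pairing c v (x + y) = pairing c v x + pairing c v y := by
  simp [pairing, mul_add, Finset.sum_add_distrib]

theorem pairing_sub (c : V → V → ℤ) (v : V) (x y : V → ℤ) :
    pairing c v (x - y) = pairing c v x - pairing c v y := by
  simp [pairing, mul_sub, Finset.sum_sub_distrib]

theorem pairing_single [DecidableEq V] (c : V → V → ℤ) (v : V) : pairing c v (Pi.single v 1) = c v v := by
  simp [pairing, Pi.single_apply]

/-- Only the diagonal entry may be negative, and it does not matter when the coordinate `v` is
fixed. -/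
theorem pairing_mono {c : V → V → ℤ} (hc : ∀ v y, v ≠ y → 0 ≤ c v y) {v : V} {x y : V → ℤ}
    (hxy : x ≤ y) (hv : x v = y v) : pairing c v x ≤ pairing c v y := by
  refine Finset.sum_le_sum fun z _ => ?_
  by_cases hz : v = z
  · subst hz; rw [hv]
  · exact mul_le_mul_of_nonneg_left (hxy z) (hc v z hz)

theorem pairing_congr_diag {c c' : V → V → ℤ} {v : V} (h : ∀ y, v ≠ y → c' v y = c v y)
    (x : V → ℤ) : pairing c' v x = pairing c v x + (c' v v - c v v) * x v := by
  rw [← sub_eq_iff_eq_add', pairing, pairing, ← Finset.sum_sub_distrib,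
    Finset.sum_eq_single_of_mem v (Finset.mem_univ v)]
  · ring
  · intro y _ hy
    rw [h y hy.symm, sub_self]

end Pairing

/-! ### Rationality implies collapsibility -/

section Collapsibility

variable {V : Type*} [LinearOrder V]

theorem Collapsible.congr {F F' : (V → ℤ) → ℤ} {a b : V → ℤ} (hC : Collapsible F a b)
    (h : ∀ x, a ≤ x → x ≤ b → F x = F' x) : Collapsible F' a b := by
  induction hC with
  | point a => exact .point a
  | @top a b v hv hF hC ih =>
    refine .top v hv (fun x h1 h2 h3 => ?_)
      (ih fun x h1 h2 => h x h1 (h2.trans (sub_le_self b (by simp))))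
    rw [← h x h1 h2, ← h (x - Pi.single v 1) ?_ ((sub_le_self x (by simp)).trans h2)]
    · exact hF x h1 h2 h3
    · intro y
      by_cases hy : y = v
      · subst hy; simp only [Pi.sub_apply, Pi.single_eq_same]; omega
      · simpa [hy] using h1 y
  | @bot a b v hv hF hC ih =>
    refine .bot v hv (fun x h1 h2 h3 => ?_)
      (ih fun x h1 h2 => h x (le_trans (by simp) h1) h2)
    rw [← h x h1 h2, ← h (x + Pi.single v 1) (h1.trans (by simp)) ?_]
    · exact hF x h1 h2 h3
    · intro y
      by_cases hy : y = v
      · subst hy; simp only [Pi.add_apply, Pi.single_eq_same]; omega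
      · simpa [hy] using h2 y

variable [Fintype V]

variable {w : (V → ℤ) → ℤ} {c c' : V → V → ℤ} {A : V → ℤ} {N : Finset V}

/-- Let `w` be a quadratic weight with the quadratic form given by `c`. If after a change of the
diagonal entries outside `N` there is a rational form, then for all families of parallel cubes
transversal to `N` the finite boxes in the directions `N` are collapsible. -/
theorem collapsible_of_rational (hc : ∀ v y, v ≠ y → 0 ≤ c v y)
    (hw : ∀ x v, w (x + Pi.single v 1) = w x + (A v - pairing c v x))
    (hcc' : ∀ v y, v ≠ y → c' v y = c v y) (hN : ∀ v ∈ N, c' v v = c v v)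
    (hrat : ∀ z : V → ℤ, 0 < z → ∃ v, 0 < z v ∧ pairing c' v z < c' v v + 2)
    (n : ℕ) (I : Finset V) (s a b : V → ℤ) (hI : Disjoint I N) (hab : a ≤ b)
    (habN : ∀ x, x ∉ N → a x = b x) (hn : (I.card : ℤ) + ∑ x, (b x - a x) ≤ n) :
    Collapsible (fun x => cubeWeight w (x + s) I) a b := by
  induction n generalizing I s a b with
  | zero =>
    have h0 : ∑ x, (b x - a x) = 0 := by
      refine le_antisymm (by push_cast at hn; omega) (Finset.sum_nonneg fun x _ => ?_)
      exact sub_nonneg.2 (hab x)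
    rw [Finset.sum_eq_zero_iff_of_nonneg fun x _ => sub_nonneg.2 (hab x)] at h0
    have : a = b := funext fun x => (sub_eq_zero.1 (h0 x (Finset.mem_univ x))).symm
    subst this
    exact .point a
  | succ n ih =>
    push_cast at hn
    have memN : ∀ {v}, a v < b v → v ∈ N := fun {v} hv => by
      by_contra h; exact hv.ne (habN v h)
    have single_sum : ∀ v : V, ∑ x, (Pi.single v 1 : V → ℤ) x = 1 := by
      intro v; simp [Pi.single_apply]
    -- Among the vertices of the cubes over the layer `x v = b v`, the pairing with `v` is largest
    -- at `b + s + vertexVec I`, so this single inequality makes the top layer removable.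
    by_cases h_top : ∃ v, a v < b v ∧ pairing c v (b + s + vertexVec I) - c v v ≤ A v
    · obtain ⟨v, hv, hA⟩ := h_top
      have hvN := memN hv
      have hvI : v ∉ I := fun h => Finset.disjoint_left.1 hI h hvN
      refine .top v hv (fun x h1 h2 h3 => ?_) (ih I s a _ hI (fun y => ?_) (fun y hy => ?_) ?_)
      · rw [cubeWeight_le_iff]
        intro S hS
        have hvS : v ∉ S := fun h => hvI (hS h)
        refine le_trans ?_ (le_cubeWeight w _ hS)
        have e : x + s + vertexVec S = x - Pi.single v 1 + s + vertexVec S + Pi.single v 1 := by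
          abel
        have e' : x - Pi.single v 1 + s + vertexVec S = x + s + vertexVec S - Pi.single v 1 := by
          abel
        have hm : pairing c v (x + s + vertexVec S) ≤ pairing c v (b + s + vertexVec I) := by
          refine pairing_mono hc (add_le_add (add_le_add_left h2 s) (vertexVec_mono hS)) ?_
          simp [vertexVec_apply, hvI, hvS, h3]
        rw [e, hw, e', pairing_sub, pairing_single]
        linarith
      · by_cases hy : y = v
        · subst hy; simp only [Pi.sub_apply, Pi.single_eq_same]; omega
        · simpa [hy] using hab y
      · have : y ≠ v := by rintro rfl; exact hy hvN
        simp [this, habN y hy]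
      · have := single_sum v
        simp only [Pi.sub_apply, Finset.sum_sub_distrib] at hn this ⊢
        omega
    -- Dually, the pairing is smallest at `a + s` on the bottom layer.
    by_cases h_bot : ∃ v, a v < b v ∧ A v ≤ pairing c v (a + s)
    · obtain ⟨v, hv, hA⟩ := h_bot
      have hvN := memN hv
      have hvI : v ∉ I := fun h => Finset.disjoint_left.1 hI h hvN
      refine .bot v hv (fun x h1 h2 h3 => ?_) (ih I s _ b hI (fun y => ?_) (fun y hy => ?_) ?_)
      · rw [cubeWeight_le_iff]
        intro S hS
        have hvS : v ∉ S := fun h => hvI (hS h)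
        refine le_trans ?_ (le_cubeWeight w _ hS)
        have e : x + Pi.single v 1 + s + vertexVec S = x + s + vertexVec S + Pi.single v 1 := by
          abel
        have hm : pairing c v (a + s) ≤ pairing c v (x + s + vertexVec S) := by
          refine pairing_mono hc (fun y => ?_) ?_
          · have : a y ≤ x y := h1 y
            simp only [Pi.add_apply, vertexVec_apply]
            split_ifs <;> omega
          · simp [vertexVec_apply, hvS, h3]
        rw [e, hw]
        linarith
      · by_cases hy : y = v
        · subst hy; simp only [Pi.add_apply, Pi.single_eq_same]; omega
        · simpa [hy] using hab y
      · have : y ≠ v := by rintro rfl; exact hy hvN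
        simp [this, habN y hy]
      · have := single_sum v
        simp only [Pi.add_apply, Finset.sum_sub_distrib, Finset.sum_add_distrib] at hn this ⊢
        omega
    -- If one end in direction `j` dominates throughout the box, each cube weighs as much as its
    -- face there, and `j` leaves `I`. The translation `s` records the chosen end.
    have drop : ∀ j ∈ I, ∀ t : Bool,
        (∀ x, a ≤ x → x ≤ b → ∀ S ⊆ I.erase j, w (shift (x + s) j (!t) + vertexVec S) ≤
          w (shift (x + s) j t + vertexVec S)) →
        Collapsible (fun x => cubeWeight w (x + s) I) a b := by
      intro j hj t h
      refine (ih (I.erase j) (shift s j t) a b (hI.mono_left (Finset.erase_subset _ _)) hab habN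
        ?_).congr fun x h1 h2 => ?_
      · have := Finset.card_erase_add_one hj
        omega
      · have hs : x + shift s j t = shift (x + s) j t := by simp only [shift, add_assoc]
        have := cubeWeight_insert_eq w (N := ∅) (l := x + s) (Finset.notMem_erase j I) t
          fun S hS => by
            obtain rfl : S = ∅ := by simpa using hS
            rw [vertexVec_empty, add_zero, add_zero, cubeWeight_le_iff]
            intro T hT
            rw [Finset.sdiff_empty] at hT ⊢
            exact (h x h1 h2 T hT).trans (le_cubeWeight w _ hT)
        rw [Finset.insert_erase hj] at this
        rw [this, hs]
    by_cases h_up : ∃ j ∈ I, pairing c j (b + s + vertexVec I) - c j j ≤ A j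
    · obtain ⟨j, hj, hA⟩ := h_up
      have hjN : j ∉ N := Finset.disjoint_left.1 hI hj
      refine drop j hj true fun x h1 h2 S hS => ?_
      have hjS : j ∉ S := fun h => Finset.notMem_erase j I (hS h)
      have e : x + s + Pi.single j 1 + vertexVec S = x + s + vertexVec S + Pi.single j 1 := by
        abel
      have hm : pairing c j (x + s + vertexVec S + Pi.single j 1) ≤
          pairing c j (b + s + vertexVec I) := by
        have hS' : insert j S ⊆ I := Finset.insert_subset hj (hS.trans (Finset.erase_subset _ _))
        have e' : x + s + vertexVec S + Pi.single j 1 = x + s + vertexVec (insert j S) := by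
          rw [vertexVec_insert hjS]; abel
        rw [e']
        refine pairing_mono hc (add_le_add (add_le_add_left h2 s) (vertexVec_mono hS')) ?_
        have h1j : a j ≤ x j := h1 j
        have h2j : x j ≤ b j := h2 j
        have := habN j hjN
        simp [vertexVec_apply, hj]
        omega
      rw [pairing_add, pairing_single] at hm
      rw [shift_true, Bool.not_true, shift_false, e, hw]
      linarith
    by_cases h_low : ∃ j ∈ I, A j ≤ pairing c j (a + s)
    · obtain ⟨j, hj, hA⟩ := h_low
      have hjN : j ∉ N := Finset.disjoint_left.1 hI hj
      refine drop j hj false fun x h1 h2 S hS => ?_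
      have hjS : j ∉ S := fun h => Finset.notMem_erase j I (hS h)
      have e : x + s + Pi.single j 1 + vertexVec S = x + s + vertexVec S + Pi.single j 1 := by
        abel
      have hm : pairing c j (a + s) ≤ pairing c j (x + s + vertexVec S) := by
        refine pairing_mono hc (fun y => ?_) ?_
        · have : a y ≤ x y := h1 y
          simp only [Pi.add_apply, vertexVec_apply]
          split_ifs <;> omega
        · have h1j : a j ≤ x j := h1 j
          have h2j : x j ≤ b j := h2 j
          have := habN j hjN
          simp [vertexVec_apply, hjS]
          omega
      rw [shift_false, Bool.not_false, shift_true, e, hw]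
      linarith
    push Not at h_top h_bot h_up h_low
    by_cases hne : a = b
    · subst hne; exact .point a
    exfalso
    -- No move is possible. With integer values, the strict failures at the two extreme corners
    -- differ by at least `c v v + 2` at each `v` in the support of this vector.
    have hz : 0 < b - a + vertexVec I := by
      refine lt_of_lt_of_le (sub_pos.2 (lt_of_le_of_ne hab hne)) (le_add_of_nonneg_right ?_)
      exact vertexVec_mono (Finset.empty_subset I)
    obtain ⟨v, hv, hlt⟩ := hrat _ hz
    have e : b - a + vertexVec I = b + s + vertexVec I - (a + s) := by abel
    have key : a v < b v ∨ v ∈ I := by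
      by_contra hcon
      push Not at hcon
      have := hab v
      simp [vertexVec_apply, hcon.2] at hv
      omega
    have hp : c v v + 2 ≤ pairing c v (b - a + vertexVec I) := by
      rw [e, pairing_sub]
      rcases key with h | h
      · linarith [h_top v h, h_bot v h]
      · linarith [h_up v h, h_low v h]
    rw [pairing_congr_diag (hcc' v)] at hlt
    by_cases hvN : v ∈ N
    · rw [hN v hvN] at hlt
      linarith
    -- Coefficient 1 makes the changes in `pairing c' v z` and in `c' v v` cancel.
    · have h1 : (b - a + vertexVec I) v = 1 := by
        have hvI : v ∈ I := key.resolve_left fun h => hvN (memN h)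
        simp [vertexVec_apply, hvI, habN v hvN]
      rw [h1] at hlt
      linarith

end Collapsibility

end LatticeCochains

/-! ### Weights of plumbing graphs and the vanishing theorem -/

namespace PlumbingGraph

open LatticeCochains

theorem toRat_add {V : Type*} (x y : V → ℤ) : toRat (x + y) = toRat x + toRat y := by
  funext v; simp [toRat]

theorem toRat_single {V : Type*} [DecidableEq V] (v : V) : toRat (Pi.single v 1 : V → ℤ) = Pi.single v 1 := by
  funext x; simp [toRat, Pi.single_apply]

variable {V : Type*} [Fintype V] [LinearOrder V]

theorem form_add_left (G : PlumbingGraph V) (x y z : V → ℚ) :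
    G.form (x + y) z = G.form x z + G.form y z := by
  simp [form, add_dotProduct]

theorem form_add_right (G : PlumbingGraph V) (x y z : V → ℚ) :
    G.form x (y + z) = G.form x y + G.form x z := by
  simp [form, Matrix.mulVec_add, dotProduct_add]

theorem form_single_left (G : PlumbingGraph V) (v : V) (y : V → ℚ) :
    G.form (Pi.single v 1) y = G.intersectionMatrix.mulVec y v := by
  rw [form, single_one_dotProduct]

open Classical in
/-- The integral entries of the intersection matrix. -/
noncomputable def intersectionNumber (G : PlumbingGraph V) (v y : V) : ℤ :=
  if v = y then G.euler v else if G.graph.Adj v y then 1 else 0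

theorem mulVec_toRat (G : PlumbingGraph V) (x : V → ℤ) (v : V) :
    G.intersectionMatrix.mulVec (toRat x) v = (pairing G.intersectionNumber v x : ℤ) := by
  rw [Matrix.mulVec, dotProduct, pairing]
  push_cast
  refine Finset.sum_congr rfl fun y _ => ?_
  congr 1
  simp only [intersectionMatrix, Matrix.of_apply, intersectionNumber]
  push_cast
  rfl

theorem weight_add_single (G : PlumbingGraph V) {k : V → ℚ} (hk : k ∈ G.Char) (x : V → ℤ) (v : V) :
    G.weight k (x + Pi.single v 1) = G.weight k x +
      (G.weight k (Pi.single v 1) - pairing G.intersectionNumber v x) := by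
  have h : (G.weight k (x + Pi.single v 1) : ℚ) = G.weight k x +
      (G.weight k (Pi.single v 1) - (pairing G.intersectionNumber v x : ℤ)) := by
    rw [G.weight_eq_chi hk, G.weight_eq_chi hk, G.weight_eq_chi hk, ← mulVec_toRat,
      ← form_single_left, chi, chi, chi, toRat_add, toRat_single]
    simp only [form_add_left, form_add_right]
    rw [G.form_comm (toRat x) (Pi.single v 1)]
    ring
  exact_mod_cast h

theorem weight_bddBelow (G : PlumbingGraph V) (hG : G.IsNegDef) (k : V → ℚ) :
    ∃ B₀ : ℤ, ∀ x, B₀ ≤ G.weight k x := by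
  -- Completing the square with `k = 2h`: `χ_k(l) = (h, h)/2 - (l + h, l + h)/2`, and the last form
  -- is non-positive.
  obtain ⟨h, rfl⟩ : ∃ h : V → ℚ, k = h + h := ⟨(1 / 2 : ℚ) • k, by rw [← add_smul]; norm_num⟩
  refine ⟨⌊G.form h h / 2⌋, fun x => Int.floor_le_floor ?_⟩
  have hneg : G.form (toRat x + h) (toRat x + h) ≤ 0 := by
    by_cases h0 : toRat x + h = 0
    · rw [h0]; simp [form]
    · exact (hG _ h0).le
  rw [chi]
  simp only [form_add_left, form_add_right] at hneg ⊢
  rw [G.form_comm h (toRat x)] at hneg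
  linarith

/-- Positivity of `χ` at `z` means `∑ z_v (E_v, z + k_can) < 0`, so some term with `z_v > 0` is
negative; adjunction turns it into this inequality. -/
theorem IsRational.exists_pairing_lt {G : PlumbingGraph V} (hG : G.IsRational) {z : V → ℤ}
    (hz : 0 < z) :
    ∃ v, 0 < z v ∧ pairing G.intersectionNumber v z < G.intersectionNumber v v + 2 := by
  by_contra hcon
  push Not at hcon
  have hpos := hG.2 z hz
  have hnonneg : 0 ≤ G.form (toRat z) (toRat z + G.canonicalCycle) := by
    refine Finset.sum_nonneg fun v _ => ?_
    rcases (hz.le v).lt_or_eq with hv | hv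
    · have hcan : G.intersectionMatrix.mulVec G.canonicalCycle v = -(G.euler v : ℚ) - 2 := by
        rw [← form_single_left, form_comm, G.form_canonicalCycle hG.1]
      refine mul_nonneg (Int.cast_nonneg (hz.le v)) ?_
      rw [Matrix.mulVec_add, Pi.add_apply, mulVec_toRat, hcan]
      have h := hcon v hv
      rw [show G.intersectionNumber v v = G.euler v by simp [intersectionNumber]] at h
      have h' : ((G.euler v + 2 : ℤ) : ℚ) ≤ (pairing G.intersectionNumber v z : ℤ) := by
        exact_mod_cast h
      push_cast at h'
      linarith
    · have : toRat z v = 0 := by simp only [toRat]; exact_mod_cast hv.symm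
      rw [this, zero_mul]
  rw [chi] at hpos
  linarith

end PlumbingGraph

open LatticeCochains in
theorem corollary3p3p3 {V : Type*} [Fintype V] [LinearOrder V] (G : PlumbingGraph V)
    (hG : G.IsNegDef) (ν : ℕ) (hν : 1 ≤ ν) (hbad : G.HasBadVertices ν)
    (k : V → ℚ) (hk : k ∈ G.Char) (q : ℕ) (hq : ν ≤ q) :
    Subsingleton (G.Cohomology k q) := by
  obtain ⟨J, rfl, e', -, he', hrat⟩ := hbad
  obtain ⟨B₀, hB⟩ := G.weight_bddBelow hG k
  have hcol : FibersCollapsible Jᶜ (G.weight k) := by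
    intro I hI a b hab habN
    have := collapsible_of_rational (c := G.intersectionNumber)
      (c' := (G.withEuler e').intersectionNumber) (N := Jᶜ)
      (fun v y hvy => by simp only [PlumbingGraph.intersectionNumber, if_neg hvy]; split_ifs <;> simp)
      (G.weight_add_single hk)
      (fun v y hvy => by
        simp only [PlumbingGraph.intersectionNumber, if_neg hvy]; rfl)
      (fun v hv => by
        simpa [PlumbingGraph.intersectionNumber, PlumbingGraph.withEuler] using
          he' v (Finset.mem_compl.1 hv))
      (fun z hz => hrat.exists_pairing_lt hz)
      (I.card + ∑ x, (b x - a x)).toNat I 0 a b hI hab habN (Int.self_le_toNat _)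
    simpa using this
  obtain ⟨p, rfl⟩ : ∃ p, q = p + 1 := ⟨q - 1, by omega⟩
  refine subsingleton_latticeCohomology ?_
  have := hcol.exactInDegree Polynomial.X (M := TPlus) hB exists_X_smul_eq J
    (Finset.card_pos.1 hν) disjoint_compl_right hq
  rwa [Finset.union_compl] at this
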